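/- Call a finite set $A$ of real numbers convex if its $n=|A|$ elements can be listed as $a_1,\dots,a_n$ in such a way that $a_i-a_{i-1}<a_{i+1}-a_i$ for every $2\le i\le n-1$; in particular, $A$ is convex if the gaps between consecutive elements, taken in increasing order, strictly increase. Let $\mathsf{E}(A)$ be the additive energy of $A$, that is, the number of quadruples $(a,b,c,d)\in A^4$ with $a-b=c-d$. All logarithms are to base $2$. (i) There is an absolute constant $C>0$ such that every convex set $A\subset\mathbb{R}$ with $|A|\ge 2$ satisfies $$\mathsf{E}(A)\le C\,|A|^{32/13}\,(\log|A|)^{71/65}.$$ (ii) There is an absolute constant $C>0$ such that every convex set $A\subset\mathbb{Z}$ with $|A|\ge 2$ satisfies $$\int_0^{2\pi}\Bigl|\sum_{a\in A}e^{2\pi i a\theta}\Bigr|^4\,d\theta\le C\,|A|^{32/13}\,(\log|A|)^{71/65}.$$ -/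

import Mathlib

/-- A finite set `A` is convex if its `n = |A|` elements can be listed as `a 0, …, a (n - 1)`
with strictly increasing consecutive gaps: `a (i + 1) - a i < a (i + 2) - a (i + 1)`.
(The terms listed are automatically pairwise distinct, there being `|A|` of them.) -/
def IsConvexSet {G : Type*} [Sub G] [LT G] (A : Finset G) : Prop :=
  ∃ a : ℕ → G, a '' Set.Iio A.card = (A : Set G) ∧
    ∀ i : ℕ, i + 2 < A.card → a (i + 1) - a i < a (i + 2) - a (i + 1)

/-- The trigonometric polynomial `P_A(θ) = ∑_{a ∈ A} e^{2π i a θ}` of a finite set of integers. -/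
noncomputable def trigPoly (A : Finset ℤ) (θ : ℝ) : ℂ :=
  ∑ a ∈ A, Complex.exp (2 * (Real.pi : ℂ) * Complex.I * (a : ℂ) * (θ : ℂ))

/-!
Write `r(x)` for the number of representations of `x` as a difference of two elements of `A`, and
`n = |A|`. The argument has three ingredients.

**Rich differences.** For a convex set and any finite `B`, at most `O(n |B| ^ 2 / k ^ 3)` elements
have `k` representations `a - b` (`IsConvexSet.hasRichBound`). This plays the role of the
Szemerédi–Trotter theorem, but convexity gives it directly: the representations of a fixed `x` form
a chain in (index in `A`) × (rank in `B`), so when both coordinates are cut into about `k / 8`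
blocks, half of the representations share their cell with an earlier one. Such a pair
`a i' - b' = a i - b` is determined by `i - i'`, `b`, `b'`, since `a (i' + δ) - a i'` is injective
in `i'`, and there are only `O((n / k) |B| (|B| / k))` choices of these. Consequences are
`E(A, B) ≪ n |B| ^ (3 / 2)` and `∑ r ^ 3 ≪ n ^ 3 log n`.

**A spectral lower bound.** Let `P` be the set of differences with `r ≥ t` and `p = |P|`. The
matrix `N = (r(y - z))` on `A` is positive semidefinite and dominates `t M` entrywise, where `M` is
the indicator of `y - z ∈ P`. Hence `tr (M N M) ≥ t (t p / n) ^ 3`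
(`mul_card_cube_le_triangles`). By Cauchy–Schwarz the square of this trace is at most
`(∑ r ^ 3) · Q` with `Q = ∑ r(a - b) ^ 2` over `a, b ∈ P` (`triangles_sq_le`).

**Popular differences of popular differences.** The energy estimates for `E(A, P)` and for
`E(A, {r ≥ j})` give `Q ≪ n ^ 4 p ^ (1 / 2) t ^ (-2) log n`
(`HasRichBound.sum_sq_diffRep_sub_le`).

Together, `t ^ 10 p ^ (11 / 2) ≪ n ^ 13 (log n) ^ 2` (`HasRichBound.level_le`). Summing
`∑ r ^ 2` over the levels `t`, with this bound for `t ≤ n ^ (7 / 13) (log n) ^ (-4 / 13)` and with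
`p ≪ n ^ 3 / t ^ 3` beyond, gives `E(A) ≪ n ^ (32 / 13) (log n) ^ (4 / 13)`, which is stronger than
required since `4 / 13 < 71 / 65`. For a set of integers, the integral over `[0, 2π]` is at most
the integral over the seven full periods `[0, 7]`, which equals `7 E(A)`.
-/

open Finset

/-! ### Rich differences of convex sets -/

/-- The counting argument for rich differences `a i - b`, `i ∈ I`, `b ∈ B`. Here `ρ` ranks `B` in
such a way that the representations of any fixed number form a chain, and `hgap` is the only
consequence of convexity that is used. -/
theorem card_rich_le_of_chain {n k : ℕ} {a : ℕ → ℝ} {I : Finset ℕ} {B S : Finset ℝ} {ρ : ℝ → ℕ}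
    (hI : I ⊆ range n) (ha : Set.InjOn a I)
    (hgap : ∀ i i' j j', i' < i → j' < j → i < n → j < n → i - i' = j - j' →
      a i - a i' = a j - a j' → i = j)
    (hρ : Set.InjOn ρ B) (hρB : ∀ b ∈ B, ρ b < #B)
    (hmono : ∀ i ∈ I, ∀ i' ∈ I, i' < i → ∀ b ∈ B, ∀ b' ∈ B, a i' - b' = a i - b → ρ b' ≤ ρ b)
    (hS : ∀ x ∈ S, k ≤ #{p ∈ I ×ˢ B | a p.1 - p.2 = x}) :
    k ^ 3 * #S ≤ 162 * n * #B ^ 2 := by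
  rcases S.eq_empty_or_nonempty with rfl | ⟨x₀, hx₀⟩
  · simp
  have hkn : k ≤ n := by
    refine (hS x₀ hx₀).trans ?_
    rw [← card_range n]
    refine card_le_card_of_injOn Prod.fst (fun p hp => ?_) (fun p hp q hq h => ?_)
    · simp only [coe_filter, mem_product, Set.mem_ofPred_eq] at hp
      exact hI hp.1.1
    · simp only [coe_filter, mem_product, Set.mem_ofPred_eq] at hp hq
      refine Prod.ext h ?_
      have := hp.2.trans hq.2.symm
      rw [h] at this
      linarith
  have hkm : k ≤ #B := by
    refine (hS x₀ hx₀).trans ?_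
    refine card_le_card_of_injOn Prod.snd (fun p hp => ?_) (fun p hp q hq h => ?_)
    · simp only [coe_filter, mem_product, Set.mem_ofPred_eq] at hp
      exact hp.1.2
    · simp only [coe_filter, mem_product, Set.mem_ofPred_eq] at hp hq
      refine Prod.ext (ha hp.1.1 hq.1.1 ?_) h
      have := hp.2.trans hq.2.symm
      rw [h] at this
      linarith
  -- for `k < 4` the number of pairs `(i, b)` is a sufficient bound
  rcases Nat.lt_or_ge k 4 with hk4 | hk4
  · rcases Nat.eq_zero_or_pos k with rfl | hk0
    · simp
    have h1 : #S ≤ n * #B := by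
      calc #S ≤ #((I ×ˢ B).image fun p => a p.1 - p.2) := by
            refine card_le_card fun x hx => ?_
            obtain ⟨p, hp⟩ := card_pos.1 (hk0.trans_le (hS x hx))
            rw [mem_filter] at hp
            exact mem_image.2 ⟨p, hp.1, hp.2⟩
        _ ≤ #(I ×ˢ B) := card_image_le
        _ ≤ n * #B := by
            rw [card_product]
            exact Nat.mul_le_mul_right _ ((card_le_card hI).trans (card_range n).le)
    have h2 : k ^ 3 ≤ 3 ^ 3 := Nat.pow_le_pow_left (by omega) 3
    have h3 : #B ≤ #B ^ 2 := Nat.le_self_pow (by norm_num) _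
    calc k ^ 3 * #S ≤ 3 ^ 3 * (n * #B ^ 2) :=
          Nat.mul_le_mul h2 (h1.trans (Nat.mul_le_mul_left _ h3))
      _ ≤ 162 * n * #B ^ 2 := by nlinarith [Nat.zero_le (n * #B ^ 2)]
  set m := #B with hm
  -- the lengths of the blocks of indices and of ranks
  set h := 8 * n / k + 1 with hh
  set l := 8 * m / k + 1 with hl
  have hk0 : 0 < k := by omega
  have hhk : 8 * n < h * k := by
    rw [mul_comm h, hh]; exact Nat.lt_mul_div_succ _ hk0
  have hlk : 8 * m < l * k := by
    rw [mul_comm l, hl]; exact Nat.lt_mul_div_succ _ hk0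
  have hh0 : 0 < h := Nat.succ_pos _
  have hl0 : 0 < l := Nat.succ_pos _
  have hhk' : h * k ≤ 9 * n := by
    have := Nat.div_mul_le_self (8 * n) k
    rw [hh, add_mul]; omega
  have hlk' : l * k ≤ 9 * m := by
    have := Nat.div_mul_le_self (8 * m) k
    rw [hl, add_mul]; omega
  have hu : 8 * (n / h) < k := by
    have h1 := Nat.div_mul_le_self n h
    by_contra! h2
    nlinarith
  have hv : 8 * (m / l) < k := by
    have h1 := Nat.div_mul_le_self m l
    by_contra! h2
    nlinarith
  set u := n / h
  set v := m / l
  classical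
  -- pairs preceded, within their cell, by another representation of the same number
  let good : Finset (ℕ × ℝ) := {p ∈ I ×ˢ B | ∃ q ∈ I ×ˢ B, q.1 < p.1 ∧
    a q.1 - q.2 = a p.1 - p.2 ∧ q.1 / h = p.1 / h ∧ ρ q.2 / l = ρ p.2 / l}
  have hgood : #good ≤ h * (m * l) := by
    have hex : ∀ p ∈ good, ∃ q ∈ I ×ˢ B, q.1 < p.1 ∧
      a q.1 - q.2 = a p.1 - p.2 ∧ q.1 / h = p.1 / h ∧ ρ q.2 / l = ρ p.2 / l :=
      fun p hp => (mem_filter.1 hp).2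
    choose! q hqI hqlt hqeq hqh hql using hex
    have : #(range h ×ˢ (B ×ˢ range l)) = h * (m * l) := by simp [hm]
    rw [← this]
    refine card_le_card_of_injOn (fun p => (p.1 - (q p).1, p.2, ρ (q p).2 % l))
      (fun p hp => ?_) (fun p hp p' hp' heq => ?_)
    · have hpI := (mem_filter.1 hp).1
      rw [mem_product] at hpI
      simp only [coe_product, Set.mem_prod, mem_coe, mem_range]
      refine ⟨?_, hpI.2, Nat.mod_lt _ hl0⟩
      have h1 := hqh p hp
      have h2 := Nat.div_add_mod p.1 h
      have h3 := Nat.div_add_mod (q p).1 h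
      have h4 := Nat.mod_lt p.1 hh0
      rw [h1] at h3
      omega
    · simp only [Prod.mk.injEq] at heq
      obtain ⟨e1, e2, e3⟩ := heq
      have hpI := mem_product.1 (mem_filter.1 hp).1
      have hpI' := mem_product.1 (mem_filter.1 hp').1
      have hq2 : (q p).2 = (q p').2 := by
        refine hρ (mem_product.1 (hqI p hp)).2 (mem_product.1 (hqI p' hp')).2 ?_
        have h1 := Nat.div_add_mod (ρ (q p).2) l
        have h2 := Nat.div_add_mod (ρ (q p').2) l
        rw [hql p hp] at h1
        rw [hql p' hp', ← e2] at h2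
        omega
      refine Prod.ext ?_ e2
      refine hgap _ _ _ _ (hqlt p hp) (hqlt p' hp') (mem_range.1 (hI hpI.1))
        (mem_range.1 (hI hpI'.1)) e1 ?_
      have h1 := hqeq p hp
      have h2 := hqeq p' hp'
      rw [← hq2, ← e2] at h2
      linarith
  have hfib : ∀ x ∈ S, k ≤ 2 * #{p ∈ good | a p.1 - p.2 = x} := by
    intro x hx
    have h1 := hS x hx
    have h2 : #{p ∈ I ×ˢ B | a p.1 - p.2 = x} ≤
        #{p ∈ good | a p.1 - p.2 = x} + #{p ∈ I ×ˢ B | a p.1 - p.2 = x ∧ p ∉ good} := by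
      rw [← filter_filter, ← card_filter_add_card_filter_not (s := {p ∈ I ×ˢ B | a p.1 - p.2 = x})
        (fun p => p ∈ good)]
      refine Nat.add_le_add_right (card_le_card fun p hp => ?_) _
      simp only [mem_filter] at hp ⊢
      exact ⟨hp.2, hp.1.2⟩
    have key : ∀ p ∈ I ×ˢ B, ∀ p' ∈ I ×ˢ B, a p.1 - p.2 = x → a p'.1 - p'.2 = x → p ∉ good →
        p.1 / h + ρ p.2 / l = p'.1 / h + ρ p'.2 / l → ¬ p'.1 < p.1 := by
      intro p hp p' hp' e e' hng hφ hlt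
      have hp2 := mem_product.1 hp
      have hp2' := mem_product.1 hp'
      have h3 := hmono _ hp2.1 _ hp2'.1 hlt _ hp2.2 _ hp2'.2 (e'.trans e.symm)
      have h4 := Nat.div_le_div_right (c := l) h3
      have h5 := Nat.div_le_div_right (c := h) hlt.le
      exact hng (mem_filter.2 ⟨hp, p', hp', hlt, e'.trans e.symm, by omega, by omega⟩)
    -- along a chain, the sum of the two block numbers determines the cell
    have h3 : #{p ∈ I ×ˢ B | a p.1 - p.2 = x ∧ p ∉ good} ≤ u + v + 1 := by
      rw [← card_range (u + v + 1)]
      refine card_le_card_of_injOn (fun p => p.1 / h + ρ p.2 / l)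
        (fun p hp => ?_) (fun p hp p' hp' heq => ?_)
      · rw [mem_coe, mem_filter, mem_product] at hp
        rw [mem_coe, mem_range]
        have h4 := Nat.div_le_div_right (c := h) (mem_range.1 (hI hp.1.1)).le
        have h5 := Nat.div_le_div_right (c := l) (hρB _ hp.1.2).le
        change p.1 / h ≤ u at h4
        change _ ≤ v at h5
        show p.1 / h + ρ p.2 / l < u + v + 1
        omega
      · rw [mem_coe, mem_filter] at hp hp'
        have h4 := key p hp.1 p' hp'.1 hp.2.1 hp'.2.1 hp.2.2 heq
        have h5 := key p' hp'.1 p hp.1 hp'.2.1 hp.2.1 hp'.2.2 heq.symm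
        have h6 : p.1 = p'.1 := by omega
        refine Prod.ext h6 ?_
        have := hp.2.1.trans hp'.2.1.symm
        rw [h6] at this
        linarith
    omega
  have hsum : k * #S ≤ 2 * #good := by
    calc k * #S = ∑ x ∈ S, k := by simp [mul_comm]
      _ ≤ ∑ x ∈ S, 2 * #{p ∈ good | a p.1 - p.2 = x} := sum_le_sum hfib
      _ = 2 * ∑ x ∈ S, #{p ∈ good | a p.1 - p.2 = x} := by rw [mul_sum]
      _ ≤ 2 * #good := by
        refine Nat.mul_le_mul_left _ ?_
        rw [← card_biUnion]
        · refine card_le_card fun p hp => ?_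
          obtain ⟨x, -, hp⟩ := mem_biUnion.1 hp
          exact (mem_filter.1 hp).1
        · intro x _ y _ hxy
          rw [Function.onFun, disjoint_left]
          intro p hp hp'
          exact hxy ((mem_filter.1 hp).2.symm.trans (mem_filter.1 hp').2)
  calc k ^ 3 * #S = k ^ 2 * (k * #S) := by ring
    _ ≤ k ^ 2 * (2 * (h * (m * l))) := Nat.mul_le_mul_left _
        (hsum.trans (Nat.mul_le_mul_left _ hgood))
    _ = 2 * (h * k) * (l * k) * m := by ring
    _ ≤ 2 * (9 * n) * (9 * m) * m := by gcongr
    _ = 162 * n * m ^ 2 := by ring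

/-- The number of representations of `x` as a difference `a - b` with `a ∈ A` and `b ∈ B`. -/
def diffRep {G : Type*} [Sub G] [DecidableEq G] (A B : Finset G) (x : G) : ℕ :=
  #{p ∈ A ×ˢ B | p.1 - p.2 = x}

/-- The Szemerédi–Trotter type property with constant `C`: for all finite `B`, at most
`C |A| |B| ^ 2 / k ^ 3` elements have at least `k` representations as a difference `a - b`. -/
def HasRichBound {G : Type*} [Sub G] [DecidableEq G] (C : ℝ) (A : Finset G) : Prop :=
  ∀ (B S : Finset G) (k : ℕ), (∀ x ∈ S, k ≤ diffRep A B x) →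
    (k : ℝ) ^ 3 * #S ≤ C * #A * (#B : ℝ) ^ 2

theorem exists_rank (B : Finset ℝ) : ∃ ρ : ℝ → ℕ, (∀ b ∈ B, ρ b < #B) ∧
    ∀ b ∈ B, ∀ b' ∈ B, b < b' → ρ b < ρ b' := by
  refine ⟨fun b => #{c ∈ B | c < b}, fun b hb => ?_, fun b hb b' hb' h => ?_⟩
  · refine card_lt_card ((ssubset_iff_of_subset (filter_subset _ _)).2 ⟨b, hb, by simp⟩)
  · refine card_lt_card ((ssubset_iff_of_subset ?_).2 ⟨b, by simp [hb, h], by simp⟩)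
    intro c hc
    rw [mem_filter] at hc ⊢
    exact ⟨hc.1, hc.2.trans h⟩

theorem strictMono_gap {n : ℕ} {a : ℕ → ℝ}
    (ha : ∀ i, i + 2 < n → a (i + 1) - a i < a (i + 2) - a (i + 1)) :
    ∀ i j, i < j → j + 1 < n → a (i + 1) - a i < a (j + 1) - a j := by
  intro i j hij
  induction j, hij using Nat.le_induction with
  | base => exact fun h => ha i h
  | succ j hj ih => exact fun h => (ih (by omega)).trans (ha j h)

/-- For a convex listing, the difference `a (i' + δ) - a i'` determines `i'` once `δ > 0` is
given. -/
theorem sub_injective_of_convex {n : ℕ} {a : ℕ → ℝ}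
    (ha : ∀ i, i + 2 < n → a (i + 1) - a i < a (i + 2) - a (i + 1)) :
    ∀ i i' j j', i' < i → j' < j → i < n → j < n → i - i' = j - j' →
      a i - a i' = a j - a j' → i = j := by
  have key : ∀ d i j, i < j → j + (d + 1) < n →
      a (i + (d + 1)) - a i < a (j + (d + 1)) - a j := by
    intro d i j hij
    induction d with
    | zero => exact fun h => strictMono_gap ha i j hij h
    | succ d ih =>
      intro h
      have h1 := ih (by omega)
      have h2 := strictMono_gap ha (i + (d + 1)) (j + (d + 1)) (by omega) (by omega)
      rw [← add_assoc i, ← add_assoc j]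
      linarith
  intro i i' j j' hi hj hin hjn hd he
  obtain ⟨d, rfl⟩ := Nat.exists_eq_add_of_lt hi
  have hj2 : j = j' + (d + 1) := by omega
  subst hj2
  rw [add_assoc] at he
  rcases lt_trichotomy i' j' with h | h | h
  · have := key d i' j' h hjn
    linarith
  · omega
  · have := key d j' i' h (by omega)
    linarith

/-- A convex listing splits into a decreasing part followed by an increasing one, and on each
part the solutions of `a - b = x` form a chain. -/
theorem IsConvexSet.hasRichBound {A : Finset ℝ} (hA : IsConvexSet A) : HasRichBound 2592 A := by
  classical
  obtain ⟨a, himg, hconv⟩ := hA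
  set n := #A with hn
  have hgap := sub_injective_of_convex hconv
  have hmemA : ∀ i < n, a i ∈ A := fun i hi => by
    rw [← mem_coe, ← himg]; exact ⟨i, hi, rfl⟩
  intro B S k hS
  rw [← hn]
  let I₂ : Finset ℕ := {i ∈ range n | ∀ j, i ≤ j → j + 1 < n → 0 < a (j + 1) - a j}
  let I₁ : Finset ℕ := {i ∈ range n | ¬ ∀ j, i ≤ j → j + 1 < n → 0 < a (j + 1) - a j}
  have hI₂ : ∀ i ∈ I₂, ∀ i' ∈ I₂, i' < i → a i' < a i := by
    intro i hi i' hi' hlt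
    rw [mem_filter, mem_range] at hi hi'
    obtain ⟨hin, -⟩ := hi
    induction i, hlt using Nat.le_induction with
    | base => linarith [hi'.2 i' le_rfl hin]
    | succ i hle ih => linarith [hi'.2 i (by omega) hin, ih (by omega)]
  have hI₁ : ∀ i ∈ I₁, ∀ i' ∈ I₁, i' < i → a i < a i' := by
    intro i hi i' hi' hlt
    rw [mem_filter, mem_range] at hi hi'
    obtain ⟨hin, hi2⟩ := hi
    push Not at hi2
    obtain ⟨j, hj, hjn, hj0⟩ := hi2
    have hstep : ∀ l < i, a (l + 1) < a l := fun l hl => by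
      linarith [strictMono_gap hconv l j (by omega) hjn]
    clear hj
    induction i, hlt using Nat.le_induction with
    | base => exact hstep i' (by omega)
    | succ i hle ih =>
      exact (hstep i (by omega)).trans (ih (by omega) fun l hl => hstep l (by omega))
  obtain ⟨ρ, hρB, hρ⟩ := exists_rank B
  have hρinj : Set.InjOn ρ B := by
    intro b hb b' hb' h
    rcases lt_trichotomy b b' with h1 | h1 | h1
    · exact absurd h (hρ b hb b' hb' h1).ne
    · exact h1
    · exact absurd h (hρ b' hb' b hb h1).ne'
  -- the number `k'` is `⌈k / 2⌉`
  set k' := (k + 1) / 2 with hk'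
  let S₁ : Finset ℝ := {x ∈ S | k' ≤ #{p ∈ I₁ ×ˢ B | a p.1 - p.2 = x}}
  let S₂ : Finset ℝ := {x ∈ S | k' ≤ #{p ∈ I₂ ×ˢ B | a p.1 - p.2 = x}}
  have b₂ : k' ^ 3 * #S₂ ≤ 162 * n * #B ^ 2 := by
    refine card_rich_le_of_chain (filter_subset _ _) ?_ hgap hρinj hρB ?_
      (fun x hx => (mem_filter.1 hx).2)
    · intro i hi j hj h
      rcases lt_trichotomy i j with h1 | h1 | h1
      · exact absurd h (hI₂ j hj i hi h1).ne
      · exact h1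
      · exact absurd h (hI₂ i hi j hj h1).ne'
    · intro i hi i' hi' hlt b hb b' hb' he
      exact (hρ b' hb' b hb (by linarith [hI₂ i hi i' hi' hlt])).le
  have b₁ : k' ^ 3 * #S₁ ≤ 162 * n * #B ^ 2 := by
    -- along the decreasing part the rank has to be reversed
    refine card_rich_le_of_chain (ρ := fun b => #B - 1 - ρ b) (filter_subset _ _) ?_ hgap
      ?_ ?_ ?_ (fun x hx => (mem_filter.1 hx).2)
    · intro i hi j hj h
      rcases lt_trichotomy i j with h1 | h1 | h1
      · exact absurd h (hI₁ j hj i hi h1).ne'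
      · exact h1
      · exact absurd h (hI₁ i hi j hj h1).ne
    · intro b hb b' hb' h
      have h1 := hρB b hb
      have h2 := hρB b' hb'
      simp only at h
      exact hρinj hb hb' (by omega)
    · intro b hb
      have h1 := hρB b hb
      show #B - 1 - ρ b < #B
      omega
    · intro i hi i' hi' hlt b hb b' hb' he
      have := hρ b hb b' hb' (by linarith [hI₁ i hi i' hi' hlt])
      show #B - 1 - ρ b' ≤ #B - 1 - ρ b
      omega
  have hcover : S ⊆ S₁ ∪ S₂ := by
    intro x hx
    have h1 : diffRep A B x ≤
        #{p ∈ I₁ ×ˢ B | a p.1 - p.2 = x} + #{p ∈ I₂ ×ˢ B | a p.1 - p.2 = x} := by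
      refine le_trans ?_ (card_union_le _ _)
      refine (card_le_card ?_).trans
        (card_image_le (f := fun p : ℕ × ℝ => (a p.1, p.2)))
      intro p hp
      rw [mem_filter, mem_product] at hp
      obtain ⟨i, hi, hia⟩ : p.1 ∈ a '' Set.Iio n := by rw [himg]; exact hp.1.1
      refine mem_image.2 ⟨(i, p.2), ?_, by simp [hia]⟩
      simp only [mem_union, mem_filter, mem_product, mem_range, I₁, I₂]
      have hi' : i < n := hi
      have e : a i - p.2 = x := by rw [hia]; exact hp.2
      by_cases hc : ∀ j, i ≤ j → j + 1 < n → 0 < a (j + 1) - a j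
      · exact Or.inr ⟨⟨⟨hi', hc⟩, hp.1.2⟩, e⟩
      · exact Or.inl ⟨⟨⟨hi', hc⟩, hp.1.2⟩, e⟩
    have h2 := hS x hx
    simp only [mem_union, mem_filter, S₁, S₂]
    by_cases hc : k' ≤ #{p ∈ I₁ ×ˢ B | a p.1 - p.2 = x}
    · exact Or.inl ⟨hx, hc⟩
    · exact Or.inr ⟨hx, by omega⟩
  have hcard : #S ≤ #S₁ + #S₂ := (card_le_card hcover).trans (card_union_le _ _)
  have hfin : k ^ 3 * #S ≤ 2592 * n * #B ^ 2 := by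
    calc k ^ 3 * #S ≤ (2 * k') ^ 3 * (#S₁ + #S₂) := by
          gcongr; omega
      _ = 8 * (k' ^ 3 * #S₁ + k' ^ 3 * #S₂) := by ring
      _ ≤ 8 * (162 * n * #B ^ 2 + 162 * n * #B ^ 2) := by gcongr
      _ = 2592 * n * #B ^ 2 := by ring
  exact_mod_cast hfin

/-! ### Layer decompositions -/

/-- Layer decomposition of a square above the height `D`. -/
theorem sq_le_layers {r N : ℕ} (D : ℕ) (hr : r ≤ N) :
    r ^ 2 ≤ D * r + ∑ j ∈ Icc D N, if j ≤ r then 2 * j else 0 := by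
  rcases Nat.lt_or_ge r D with h | h
  · exact (by nlinarith : r ^ 2 ≤ D * r).trans (Nat.le_add_right _ _)
  have h1 : ∀ s, D ≤ s → s ^ 2 ≤ D * D + ∑ j ∈ Icc D s, 2 * j := by
    intro s hs
    induction s, hs using Nat.le_induction with
    | base => nlinarith [Nat.zero_le (∑ j ∈ Icc D D, 2 * j)]
    | succ s hs ih => rw [sum_Icc_succ_top (by omega)]; nlinarith
  have h2 : ∑ j ∈ Icc D r, 2 * j ≤ ∑ j ∈ Icc D N, if j ≤ r then 2 * j else 0 := by
    rw [← sum_filter]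
    refine sum_le_sum_of_subset fun j hj => ?_
    rw [mem_Icc] at hj
    exact mem_filter.2 ⟨mem_Icc.2 ⟨hj.1, hj.2.trans hr⟩, hj.2⟩
  nlinarith [h1 r h]

theorem cube_le_layers {r N : ℕ} (hr : r ≤ N) :
    r ^ 3 ≤ ∑ j ∈ Icc 1 N, if j ≤ r then 3 * j ^ 2 else 0 := by
  have h1 : ∀ s : ℕ, s ^ 3 ≤ ∑ j ∈ Icc 1 s, 3 * j ^ 2 := by
    intro s
    induction s with
    | zero => simp
    | succ s ih => rw [sum_Icc_succ_top (by omega)]; ring_nf at ih ⊢; omega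
  refine (h1 r).trans ?_
  rw [← sum_filter]
  refine sum_le_sum_of_subset fun j hj => ?_
  rw [mem_Icc] at hj
  exact mem_filter.2 ⟨mem_Icc.2 ⟨hj.1, hj.2.trans hr⟩, hj.2⟩

theorem sum_layers {ι : Type*} (T : Finset ℕ) (U : Finset ι) (c : ℕ → ℕ) (f : ι → ℕ) :
    ∑ x ∈ U, ∑ j ∈ T, (if j ≤ f x then c j else 0) = ∑ j ∈ T, c j * #{x ∈ U | j ≤ f x} := by
  rw [sum_comm]
  refine sum_congr rfl fun j _ => ?_
  rw [← sum_filter, sum_const, smul_eq_mul, mul_comm]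

theorem sum_sq_le_layers {ι : Type*} (U : Finset ι) (f : ι → ℕ) (D : ℕ) {N : ℕ}
    (hf : ∀ x ∈ U, f x ≤ N) :
    ∑ x ∈ U, f x ^ 2 ≤ D * ∑ x ∈ U, f x + ∑ j ∈ Icc D N, 2 * j * #{x ∈ U | j ≤ f x} := by
  rw [← sum_layers, mul_sum, ← sum_add_distrib]
  exact sum_le_sum fun x hx => sq_le_layers D (hf x hx)

theorem sum_cube_le_layers {ι : Type*} (U : Finset ι) (f : ι → ℕ) {N : ℕ}
    (hf : ∀ x ∈ U, f x ≤ N) :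
    ∑ x ∈ U, f x ^ 3 ≤ ∑ j ∈ Icc 1 N, 3 * j ^ 2 * #{x ∈ U | j ≤ f x} := by
  rw [← sum_layers]
  exact sum_le_sum fun x hx => cube_le_layers (hf x hx)

theorem sum_Icc_inv_sq_le {D : ℕ} (hD : 1 ≤ D) (N : ℕ) :
    ∑ j ∈ Icc D N, ((j : ℝ) ^ 2)⁻¹ ≤ 2 / D := by
  have h := sum_Ioo_inv_sq_le (α := ℝ) (D - 1) (N + 1)
  have e : Ioo (D - 1) (N + 1) = Icc D N := by ext; simp; omega
  rw [e] at h
  refine h.trans_eq ?_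
  rw [Nat.cast_sub hD]; simp

theorem sum_Icc_inv_le (D : ℕ) (hD : 1 ≤ D) (N : ℕ) :
    ∑ j ∈ Icc D N, (j : ℝ)⁻¹ ≤ 1 + Real.log N := by
  have h := harmonic_le_one_add_log N
  rw [harmonic_eq_sum_Icc] at h
  push_cast at h
  refine le_trans ?_ h
  exact sum_le_sum_of_subset_of_nonneg (Icc_subset_Icc_left hD) fun _ _ _ => by positivity

/-! ### Moments of the representation function -/

section Rep

variable {G : Type*} [AddCommGroup G] [DecidableEq G] {A B P D : Finset G} {C : ℝ}

theorem diffRep_le_card_left (A B : Finset G) (x : G) : diffRep A B x ≤ #A := by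
  refine card_le_card_of_injOn Prod.fst (fun p hp => ?_) (fun p hp q hq h => ?_)
  · exact (mem_product.1 (mem_filter.1 hp).1).1
  · have h1 := (mem_filter.1 hp).2.trans (mem_filter.1 hq).2.symm
    rw [h, sub_right_inj] at h1
    exact Prod.ext h h1

theorem sum_diffRep_le (A B S : Finset G) : ∑ x ∈ S, diffRep A B x ≤ #A * #B := by
  rw [← card_product]
  simp only [diffRep]
  rw [← card_biUnion]
  · refine card_le_card fun p hp => ?_
    obtain ⟨x, -, hp⟩ := mem_biUnion.1 hp
    exact (mem_filter.1 hp).1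
  · intro x _ y _ hxy
    rw [Function.onFun, disjoint_left]
    intro p hp hp'
    exact hxy ((mem_filter.1 hp).2.symm.trans (mem_filter.1 hp').2)

theorem diffRep_neg (A : Finset G) (x : G) : diffRep A A (-x) = diffRep A A x := by
  have h : ∀ y, diffRep A A (-y) ≤ diffRep A A y := fun y => by
    refine card_le_card_of_injOn Prod.swap (fun p hp => ?_) Prod.swap_injective.injOn
    simp only [mem_coe, mem_filter, mem_product, Prod.fst_swap, Prod.snd_swap] at hp ⊢
    refine ⟨hp.1.symm, ?_⟩
    rw [← neg_sub, hp.2, neg_neg]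
  exact (h x).antisymm (by simpa using h (-x))

/-- The energy estimate `E(A, B) ≪ |A| |B| ^ (3 / 2)`. -/
theorem HasRichBound.sum_sq_le (hA : HasRichBound C A) (hC : 0 ≤ C) (B S : Finset G) :
    ∑ x ∈ S, (diffRep A B x : ℝ) ^ 2 ≤ (2 + 4 * C) * #A * #B * √(#B : ℝ) := by
  rcases B.eq_empty_or_nonempty with rfl | hB
  · simp [diffRep]
  have hm : (1 : ℝ) ≤ #B := by exact_mod_cast hB.card_pos
  set s := √(#B : ℝ) with hs
  have hs1 : 1 ≤ s := Real.one_le_sqrt.2 hm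
  have hs2 : s ^ 2 = #B := Real.sq_sqrt (by linarith)
  set D := ⌈s⌉₊ with hD
  have hD1 : s ≤ D := Nat.le_ceil s
  have hD2 : (D : ℝ) ≤ 2 * s := by
    linarith [Nat.ceil_lt_add_one (show 0 ≤ s by linarith)]
  have hD0 : 1 ≤ D := by exact_mod_cast hs1.trans hD1
  have h := sum_sq_le_layers S (diffRep A B) D (N := #A) fun x _ => diffRep_le_card_left A B x
  have h1 : (∑ x ∈ S, diffRep A B x : ℝ) ≤ #A * #B := by exact_mod_cast sum_diffRep_le A B S
  have h2 : ∀ j ∈ Icc D #A, 2 * (j : ℝ) * #{x ∈ S | j ≤ diffRep A B x} ≤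
      2 * C * #A * #B ^ 2 * ((j : ℝ) ^ 2)⁻¹ := by
    intro j hj
    have hj0 : (0 : ℝ) < j := by exact_mod_cast hD0.trans (mem_Icc.1 hj).1
    have := hA B {x ∈ S | j ≤ diffRep A B x} j fun x hx => (mem_filter.1 hx).2
    rw [← div_eq_mul_inv, le_div_iff₀ (by positivity)]
    linarith
  have h3 := sum_le_sum h2
  rw [← mul_sum] at h3
  have h4 := sum_Icc_inv_sq_le hD0 #A
  have hr : (∑ x ∈ S, (diffRep A B x : ℝ) ^ 2) ≤ D * ∑ x ∈ S, (diffRep A B x : ℝ) +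
      ∑ j ∈ Icc D #A, 2 * (j : ℝ) * #{x ∈ S | j ≤ diffRep A B x} := by exact_mod_cast h
  have h5 : 2 * C * #A * #B ^ 2 * (2 / (D : ℝ)) ≤ 4 * C * #A * #B * s := by
    have : 2 / (D : ℝ) ≤ 2 / s := by gcongr
    calc 2 * C * #A * #B ^ 2 * (2 / (D : ℝ)) ≤ 2 * C * #A * #B ^ 2 * (2 / s) := by gcongr
      _ = 4 * C * #A * #B * s := by rw [← hs2]; field_simp; ring
  calc _ ≤ _ := hr
    _ ≤ 2 * s * (#A * #B) + 2 * C * #A * #B ^ 2 * (2 / (D : ℝ)) := by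
        gcongr
        exact h3.trans (by gcongr)
    _ ≤ 2 * s * (#A * #B) + 4 * C * #A * #B * s := by gcongr
    _ = (2 + 4 * C) * #A * #B * s := by ring

/-- The third moment estimate `E₃(A) ≪ |A| ^ 3 log |A|`. -/
theorem HasRichBound.sum_cube_le (hA : HasRichBound C A) (hC : 0 ≤ C) (S : Finset G) :
    ∑ x ∈ S, (diffRep A A x : ℝ) ^ 3 ≤ 3 * C * #A ^ 3 * (1 + Real.log #A) := by
  have h := sum_cube_le_layers S (diffRep A A) (N := #A) fun x _ => diffRep_le_card_left A A x
  have hr : (∑ x ∈ S, (diffRep A A x : ℝ) ^ 3) ≤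
      ∑ j ∈ Icc 1 #A, 3 * (j : ℝ) ^ 2 * #{x ∈ S | j ≤ diffRep A A x} := by exact_mod_cast h
  have h2 : ∀ j ∈ Icc 1 #A, 3 * (j : ℝ) ^ 2 * #{x ∈ S | j ≤ diffRep A A x} ≤
      3 * C * #A ^ 3 * (j : ℝ)⁻¹ := by
    intro j hj
    have hj0 : (0 : ℝ) < j := by exact_mod_cast (mem_Icc.1 hj).1
    have := hA A {x ∈ S | j ≤ diffRep A A x} j fun x hx => (mem_filter.1 hx).2
    rw [← div_eq_mul_inv, le_div_iff₀ (by positivity)]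
    linarith
  refine hr.trans ((sum_le_sum h2).trans ?_)
  rw [← mul_sum]
  gcongr
  exact sum_Icc_inv_le 1 le_rfl _

/-- Cauchy–Schwarz for the number of solutions of `x - b = y - d` with `x, y ∈ A`, `b ∈ P`,
`d ∈ D`. -/
theorem card_coincidences_sq_le (A P D : Finset G) :
    ((#{q ∈ (A ×ˢ P) ×ˢ (A ×ˢ D) | q.1.1 - q.1.2 = q.2.1 - q.2.2} : ℕ) : ℝ) ^ 2 ≤
      (∑ t ∈ (A ×ˢ P).image (fun p => p.1 - p.2), (diffRep A P t : ℝ) ^ 2) *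
      ∑ t ∈ (A ×ˢ P).image (fun p => p.1 - p.2), (diffRep A D t : ℝ) ^ 2 := by
  refine le_trans ?_ (sum_mul_sq_le_sq_mul_sq _ _ _)
  gcongr
  have h : #{q ∈ (A ×ˢ P) ×ˢ (A ×ˢ D) | q.1.1 - q.1.2 = q.2.1 - q.2.2} ≤
      ∑ t ∈ (A ×ˢ P).image (fun p => p.1 - p.2), diffRep A P t * diffRep A D t := by
    rw [card_eq_sum_card_fiberwise (f := fun q => q.1.1 - q.1.2)
      (t := (A ×ˢ P).image (fun p => p.1 - p.2))]
    · refine sum_le_sum fun t _ => ?_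
      rw [diffRep, diffRep, ← card_product]
      refine card_le_card fun q hq => ?_
      simp only [mem_filter, mem_product] at hq ⊢
      exact ⟨⟨hq.1.1.1, hq.2⟩, hq.1.1.2, hq.1.2 ▸ hq.2⟩
    · intro q hq
      rw [mem_coe, mem_filter, mem_product] at hq
      exact mem_image.2 ⟨q.1, hq.1.1, rfl⟩
  exact_mod_cast h

/-- If all elements of `P` are `t`-popular differences of `A`, each pair `a, b ∈ P` with
`a - b ∈ D` yields `t` solutions of `x - b = y - d`: write `a = x - y` and `d = b - a`. -/
theorem mul_card_diff_mem_le {t : ℕ} (hP : ∀ a ∈ P, t ≤ diffRep A A a)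
    (hD : ∀ d ∈ D, -d ∈ D) :
    t * #{p ∈ P ×ˢ P | p.1 - p.2 ∈ D} ≤
      #{q ∈ (A ×ˢ P) ×ˢ (A ×ˢ D) | q.1.1 - q.1.2 = q.2.1 - q.2.2} := by
  calc t * #{p ∈ P ×ˢ P | p.1 - p.2 ∈ D}
      = ∑ p ∈ P ×ˢ P with p.1 - p.2 ∈ D, t := by rw [sum_const, smul_eq_mul, mul_comm]
    _ ≤ ∑ p ∈ P ×ˢ P with p.1 - p.2 ∈ D, #{z ∈ A ×ˢ A | z.1 - z.2 = p.1} :=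
        sum_le_sum fun p hp => hP _ (mem_product.1 (mem_filter.1 hp).1).1
    _ = #(({p ∈ P ×ˢ P | p.1 - p.2 ∈ D} : Finset (G × G)).sigma
          fun p => {z ∈ A ×ˢ A | z.1 - z.2 = p.1}) := by rw [card_sigma]
    _ ≤ _ := by
        refine card_le_card_of_injOn
          (fun w => ((w.2.1, w.1.2), (w.2.2, w.1.2 - w.1.1))) ?_ ?_
        · rintro ⟨p, z⟩ hw
          simp only [mem_coe, mem_sigma, mem_filter, mem_product] at hw ⊢
          obtain ⟨⟨⟨hp1, hp2⟩, hpD⟩, ⟨hz1, hz2⟩, hz⟩ := hw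
          refine ⟨⟨⟨hz1, hp2⟩, hz2, ?_⟩, ?_⟩
          · rw [← neg_sub]; exact hD _ hpD
          · rw [← hz]; abel
        · rintro ⟨⟨p1, p2⟩, z1, z2⟩ _ ⟨⟨p1', p2'⟩, z1', z2'⟩ _ h
          simp only [Prod.mk.injEq] at h
          obtain ⟨⟨rfl, rfl⟩, rfl, h⟩ := h
          rw [sub_right_inj] at h
          rw [h]

end Rep

/-! ### Walks and Gram matrices -/

section Walks

variable {ι κ : Type*} {A : Finset ι} {M : ι → ι → ℝ}

theorem three_le_mul_add_inv_add_inv {u v : ℝ} (hu : 0 < u) (hv : 0 < v) :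
    3 ≤ u * v + u⁻¹ + v⁻¹ := by
  obtain ⟨a, ha, rfl⟩ : ∃ a, 0 < a ∧ a ^ 2 = u := ⟨√u, Real.sqrt_pos.2 hu, Real.sq_sqrt hu.le⟩
  obtain ⟨b, hb, rfl⟩ : ∃ b, 0 < b ∧ b ^ 2 = v := ⟨√v, Real.sqrt_pos.2 hv, Real.sq_sqrt hv.le⟩
  have hab : 0 < a * b := mul_pos ha hb
  have h1 : 3 * (a * b) ^ 2 ≤ (a * b) ^ 4 + a ^ 2 + b ^ 2 := by
    have : 0 ≤ (a * b) * ((a * b - 1) ^ 2 * (a * b + 2)) := by positivity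
    nlinarith [sq_nonneg (a - b)]
  have h2 : a ^ 2 * b ^ 2 + (a ^ 2)⁻¹ + (b ^ 2)⁻¹ =
      ((a * b) ^ 4 + a ^ 2 + b ^ 2) / (a * b) ^ 2 := by
    field_simp
    ring
  rw [h2, le_div_iff₀ (by positivity)]
  exact h1

/-- The number of walks of length three is at least what the average degree predicts: sum the
AM-GM inequality `3 ≤ (d x / μ) (d y / μ) + μ / d x + μ / d y` over the edges, where `d` is the
degree and `μ` its average. -/
theorem sum_cube_le_walks (h0 : ∀ x y, 0 ≤ M x y) (hs : ∀ x y, M x y = M y x) :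
    (∑ x ∈ A, ∑ y ∈ A, M x y) ^ 3 ≤
      #A ^ 2 * ∑ x ∈ A, ∑ y ∈ A, M x y * ((∑ z ∈ A, M x z) * ∑ z ∈ A, M y z) := by
  set d : ι → ℝ := fun x => ∑ z ∈ A, M x z with hd
  have hd0 : ∀ x, 0 ≤ d x := fun x => sum_nonneg fun z _ => h0 x z
  set S := ∑ x ∈ A, ∑ y ∈ A, M x y with hS
  set W := ∑ x ∈ A, ∑ y ∈ A, M x y * (d x * d y) with hW
  have hS0 : 0 ≤ S := sum_nonneg fun x _ => hd0 x
  rcases hS0.eq_or_lt with h | hSpos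
  · rw [← h]
    have : 0 ≤ W := sum_nonneg fun x _ => sum_nonneg fun y _ =>
      mul_nonneg (h0 x y) (mul_nonneg (hd0 x) (hd0 y))
    rw [zero_pow three_ne_zero]
    exact mul_nonneg (sq_nonneg _) this
  have hn : (0 : ℝ) < #A := by
    rcases A.eq_empty_or_nonempty with rfl | h
    · simp [hS] at hSpos
    · exact_mod_cast h.card_pos
  set μ := S / #A with hμ
  have hμ0 : 0 < μ := div_pos hSpos hn
  have hpt : ∀ x ∈ A, ∀ y ∈ A, 3 * M x y ≤
      M x y * (d x * d y) / μ ^ 2 + (μ * (M x y * (d x)⁻¹) + μ * (M y x * (d y)⁻¹)) := by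
    intro x hx y hy
    rcases (h0 x y).eq_or_lt with h | h
    · rw [hs y x, ← h]; simp
    have hdx : 0 < d x := h.trans_le (single_le_sum (f := M x) (fun z _ => h0 x z) hy)
    have hdy : 0 < d y :=
      (hs x y ▸ h).trans_le (single_le_sum (f := M y) (fun z _ => h0 y z) hx)
    have h3 := three_le_mul_add_inv_add_inv (div_pos hdx hμ0) (div_pos hdy hμ0)
    calc 3 * M x y ≤ (d x / μ * (d y / μ) + (d x / μ)⁻¹ + (d y / μ)⁻¹) * M x y := by gcongr
      _ = _ := by rw [hs y x]; field_simp; ring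
  have hinv : ∑ x ∈ A, ∑ y ∈ A, μ * (M x y * (d x)⁻¹) ≤ S := by
    calc ∑ x ∈ A, ∑ y ∈ A, μ * (M x y * (d x)⁻¹) = ∑ x ∈ A, μ * (d x * (d x)⁻¹) := by
          refine sum_congr rfl fun x _ => ?_
          rw [← mul_sum, ← sum_mul]
      _ ≤ ∑ x ∈ A, μ * 1 := by
          gcongr with x
          exact mul_inv_le_one
      _ = S := by rw [sum_const, nsmul_eq_mul, hμ]; field_simp
  have hsum := sum_le_sum fun x hx => sum_le_sum (hpt x hx)
  simp only [← mul_sum, ← sum_div, sum_add_distrib] at hsum hinv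
  have hinv' : μ * ∑ x ∈ A, ∑ y ∈ A, M y x * (d y)⁻¹ ≤ S := by rwa [sum_comm]
  have h4 : S ≤ W / μ ^ 2 := by linarith
  rw [le_div_iff₀ (by positivity), hμ, div_pow, ← mul_div_assoc, div_le_iff₀ (by positivity)] at h4
  linarith

/-- If the Gram matrix `∑ s, G s y * G s z` dominates `t M`, where `M` is symmetric and
nonnegative, then it correlates with `M ^ 2` at least as much as the average row sum of `M`
predicts. Testing `M N M` (for the Gram matrix `N`) against the constant vector gives
`tr (M N M) ≥ ⟨M N M 1, 1⟩ / |A| ≥ t ⟨M ^ 3 1, 1⟩ / |A|`. -/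
theorem mul_sum_cube_le_gram (h0 : ∀ x y, 0 ≤ M x y) (hs : ∀ x y, M x y = M y x)
    {U : Finset κ} {G : κ → ι → ℝ} {t : ℝ} (ht : 0 ≤ t)
    (hG : ∀ y ∈ A, ∀ z ∈ A, t * M y z ≤ ∑ s ∈ U, G s y * G s z) :
    t * (∑ x ∈ A, ∑ y ∈ A, M x y) ^ 3 ≤
      #A ^ 3 * ∑ x ∈ A, ∑ y ∈ A, ∑ z ∈ A, M x y * M x z * ∑ s ∈ U, G s y * G s z := by
  set d : ι → ℝ := fun x => ∑ z ∈ A, M x z with hd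
  have hd0 : ∀ x, 0 ≤ d x := fun x => sum_nonneg fun z _ => h0 x z
  set F : κ → ι → ℝ := fun s x => ∑ y ∈ A, M x y * G s y with hF
  have e1 : ∑ x ∈ A, ∑ y ∈ A, ∑ z ∈ A, M x y * M x z * ∑ s ∈ U, G s y * G s z =
      ∑ s ∈ U, ∑ x ∈ A, F s x ^ 2 := by
    rw [sum_comm (s := U)]
    refine sum_congr rfl fun x _ => ?_
    simp only [hF, sq, sum_mul_sum]
    rw [sum_comm (s := U)]
    refine sum_congr rfl fun y _ => ?_
    rw [sum_comm (s := U)]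
    refine sum_congr rfl fun z _ => ?_
    rw [mul_sum]
    exact sum_congr rfl fun s _ => by ring
  have e2 : ∀ s, ∑ x ∈ A, F s x = ∑ y ∈ A, G s y * d y := by
    intro s
    simp only [hF, hd, mul_sum]
    rw [sum_comm]
    refine sum_congr rfl fun y _ => sum_congr rfl fun x _ => ?_
    rw [hs, mul_comm]
  have e3 : t * ∑ y ∈ A, ∑ z ∈ A, M y z * (d y * d z) ≤ ∑ s ∈ U, (∑ x ∈ A, F s x) ^ 2 := by
    simp only [e2, sq, sum_mul_sum]
    rw [sum_comm (s := U), mul_sum]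
    refine sum_le_sum fun y hy => ?_
    rw [sum_comm (s := U), mul_sum]
    refine sum_le_sum fun z hz => ?_
    calc t * (M y z * (d y * d z)) = t * M y z * (d y * d z) := by ring
      _ ≤ (∑ s ∈ U, G s y * G s z) * (d y * d z) :=
          mul_le_mul_of_nonneg_right (hG y hy z hz) (mul_nonneg (hd0 y) (hd0 z))
      _ = _ := by
          rw [sum_mul]
          exact sum_congr rfl fun s _ => by ring
  rw [e1]
  calc t * (∑ x ∈ A, ∑ y ∈ A, M x y) ^ 3
      ≤ t * (#A ^ 2 * ∑ x ∈ A, ∑ y ∈ A, M x y * (d x * d y)) :=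
        mul_le_mul_of_nonneg_left (sum_cube_le_walks h0 hs) ht
    _ = #A ^ 2 * (t * ∑ x ∈ A, ∑ y ∈ A, M x y * (d x * d y)) := by ring
    _ ≤ #A ^ 2 * ∑ s ∈ U, (∑ x ∈ A, F s x) ^ 2 := by gcongr
    _ ≤ #A ^ 2 * ∑ s ∈ U, #A * ∑ x ∈ A, F s x ^ 2 := by
        gcongr with s _
        exact sq_sum_le_card_mul_sum_sq
    _ = #A ^ 3 * ∑ s ∈ U, ∑ x ∈ A, F s x ^ 2 := by rw [← mul_sum]; ring

end Walks

/-! ### Triangles of popular differences -/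

section Triangles

variable {G : Type*} [AddCommGroup G] [DecidableEq G] {A P : Finset G}

/-- `(r(y - z))` is the Gram matrix of the indicators of the shifts of `A`. -/
theorem sum_shift_eq_diffRep {y : G} (hy : y ∈ A) (z : G) :
    ∑ s ∈ (A ×ˢ A).image (fun p => p.1 - p.2),
      (if y + s ∈ A then (1 : ℝ) else 0) * (if z + s ∈ A then 1 else 0) = diffRep A A (y - z) := by
  have h : ∀ s, (if y + s ∈ A then (1 : ℝ) else 0) * (if z + s ∈ A then 1 else 0) =
      if y + s ∈ A ∧ z + s ∈ A then 1 else 0 := fun s => by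
    by_cases h1 : y + s ∈ A <;> by_cases h2 : z + s ∈ A <;> simp [h1, h2]
  simp only [h, sum_boole, diffRep]
  congr 1
  refine card_nbij' (fun s => (y + s, z + s)) (fun p => p.1 - y) ?_ ?_ ?_ ?_
  · intro s hs
    simp only [mem_coe, mem_filter, mem_product] at hs ⊢
    exact ⟨hs.2, by abel⟩
  · intro p hp
    simp only [mem_coe, mem_filter, mem_product, mem_image] at hp ⊢
    refine ⟨⟨(p.1, y), ⟨hp.1.1, hy⟩, rfl⟩, by simpa using hp.1.1, ?_⟩
    have : z + (p.1 - y) = p.2 := by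
      have := hp.2
      rw [sub_eq_iff_eq_add] at this
      rw [this]; abel
    rw [this]; exact hp.1.2
  · intro s _
    simp
  · intro p hp
    simp only [mem_coe, mem_filter, mem_product] at hp
    have := hp.2
    rw [sub_eq_iff_eq_add] at this
    refine Prod.ext (by simp) ?_
    simp only [this]; abel

theorem sum_diffRep_eq_card (A P : Finset G) :
    ∑ a ∈ P, diffRep A A a = #{p ∈ A ×ˢ A | p.1 - p.2 ∈ P} := by
  rw [card_eq_sum_card_fiberwise (f := fun p => p.1 - p.2) (t := P)]
  · refine sum_congr rfl fun a ha => ?_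
    rw [diffRep, filter_filter]
    congr 1
    ext p
    simp only [mem_filter]
    exact and_congr_right fun _ => ⟨fun h => ⟨h ▸ ha, h⟩, fun h => h.2⟩
  · intro p hp
    exact (mem_filter.1 hp).2

/-- Lower bound for the sum of `r(y - z)` over triples in `A` with `x - y, x - z ∈ P`, where `P`
consists of `t`-popular differences. -/
theorem mul_card_cube_le_triangles {t : ℕ} (hP : ∀ a ∈ P, t ≤ diffRep A A a)
    (hneg : ∀ a ∈ P, -a ∈ P) :
    (t : ℝ) * (t * #P) ^ 3 ≤ #A ^ 3 *
      ∑ q ∈ A ×ˢ A ×ˢ A with q.1 - q.2.1 ∈ P ∧ q.1 - q.2.2 ∈ P,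
        (diffRep A A (q.2.1 - q.2.2) : ℝ) := by
  have hM : ∀ x y : G, x - y ∈ P ↔ y - x ∈ P := fun x y =>
    ⟨fun h => by simpa using hneg _ h, fun h => by simpa using hneg _ h⟩
  have h := mul_sum_cube_le_gram (A := A) (M := fun x y => if x - y ∈ P then (1 : ℝ) else 0)
    (U := (A ×ˢ A).image fun p => p.1 - p.2) (G := fun s y => if y + s ∈ A then (1 : ℝ) else 0)
    (t := t) (fun x y => by positivity) (fun x y => by simp only [hM x y]) (by positivity)
    (fun y hy z _ => by
      rw [sum_shift_eq_diffRep hy z]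
      by_cases hyz : y - z ∈ P
      · simpa [hyz] using hP _ hyz
      · simp [hyz])
  have h1 : (t * #P : ℝ) ≤ ∑ x ∈ A, ∑ y ∈ A, if x - y ∈ P then (1 : ℝ) else 0 := by
    rw [← sum_product', sum_boole, ← sum_diffRep_eq_card]
    have : t * #P ≤ ∑ a ∈ P, diffRep A A a := by
      rw [mul_comm, ← smul_eq_mul, ← sum_const]
      exact sum_le_sum hP
    exact_mod_cast this
  calc (t : ℝ) * (t * #P) ^ 3
      ≤ t * (∑ x ∈ A, ∑ y ∈ A, if x - y ∈ P then (1 : ℝ) else 0) ^ 3 := by gcongr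
    _ ≤ _ := h
    _ = _ := by
        congr 1
        rw [sum_filter, sum_product]
        refine sum_congr rfl fun x _ => ?_
        rw [sum_product]
        refine sum_congr rfl fun y hy => sum_congr rfl fun z _ => ?_
        rw [sum_shift_eq_diffRep hy z]
        by_cases h1 : x - y ∈ P <;> by_cases h2 : x - z ∈ P <;> simp [h1, h2]

/-- The triples in `A` with prescribed differences `(x - z, x - y)` have second moment at most
`∑ r ^ 3`: two such triples are translates of each other, by a `d` that is a difference three
times. -/
theorem sum_card_sq_le_sum_cube (A : Finset G) (V : Finset (G × G)) :
    ∑ v ∈ V, #{q ∈ A ×ˢ A ×ˢ A | (q.1 - q.2.2, q.1 - q.2.1) = v} ^ 2 ≤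
      ∑ d ∈ (A ×ˢ A).image (fun p => p.1 - p.2), diffRep A A d ^ 3 := by
  set Z : Finset ((G × G × G) × (G × G × G)) :=
    {w ∈ (A ×ˢ A ×ˢ A) ×ˢ (A ×ˢ A ×ˢ A) | w.1.1 - w.1.2.2 = w.2.1 - w.2.2.2 ∧
      w.1.1 - w.1.2.1 = w.2.1 - w.2.2.1} with hZ
  have h1 : ∑ v ∈ V, #{q ∈ A ×ˢ A ×ˢ A | (q.1 - q.2.2, q.1 - q.2.1) = v} ^ 2 ≤ #Z := by
    simp only [sq, ← card_product]
    rw [← card_biUnion]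
    · refine card_le_card fun w hw => ?_
      obtain ⟨v, -, hw⟩ := mem_biUnion.1 hw
      rw [mem_product, mem_filter, mem_filter] at hw
      have := hw.1.2.trans hw.2.2.symm
      rw [Prod.mk.injEq] at this
      exact mem_filter.2 ⟨mem_product.2 ⟨hw.1.1, hw.2.1⟩, this⟩
    · intro v _ v' _ hne
      rw [Function.onFun, disjoint_left]
      intro w hw hw'
      rw [mem_product, mem_filter, mem_filter] at hw hw'
      exact hne (hw.1.2.symm.trans hw'.1.2)
  refine h1.trans ?_
  rw [card_eq_sum_card_fiberwise (f := fun w => w.1.1 - w.2.1)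
    (t := (A ×ˢ A).image (fun p => p.1 - p.2))]
  · refine sum_le_sum fun d _ => ?_
    have e : diffRep A A d ^ 3 = #({p ∈ A ×ˢ A | p.1 - p.2 = d} ×ˢ
        ({p ∈ A ×ˢ A | p.1 - p.2 = d} ×ˢ {p ∈ A ×ˢ A | p.1 - p.2 = d})) := by
      rw [card_product, card_product, diffRep]; ring
    rw [e]
    refine card_le_card_of_injOn
      (fun w => ((w.1.1, w.2.1), (w.1.2.1, w.2.2.1), (w.1.2.2, w.2.2.2))) ?_ ?_
    · intro w hw
      simp only [hZ, mem_coe, mem_filter, mem_product] at hw ⊢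
      obtain ⟨⟨⟨⟨a1, a2, a3⟩, b1, b2, b3⟩, h2, h3⟩, rfl⟩ := hw
      refine ⟨⟨⟨a1, b1⟩, rfl⟩, ⟨⟨a2, b2⟩, ?_⟩, ⟨a3, b3⟩, ?_⟩
      · rw [sub_eq_sub_iff_add_eq_add] at h3 ⊢
        rw [add_comm, ← h3, add_comm]
      · rw [sub_eq_sub_iff_add_eq_add] at h2 ⊢
        rw [add_comm, ← h2, add_comm]
    · rintro ⟨⟨a, b, c⟩, a', b', c'⟩ _ ⟨⟨x, y, z⟩, x', y', z'⟩ _ h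
      simp only [Prod.mk.injEq] at h ⊢
      tauto
  · intro w hw
    simp only [hZ, mem_coe, mem_filter, mem_product] at hw
    exact mem_image.2 ⟨(w.1.1, w.2.1), mem_product.2 ⟨hw.1.1.1, hw.1.2.1⟩, rfl⟩

theorem triangles_sq_le (A P : Finset G) :
    (∑ q ∈ A ×ˢ A ×ˢ A with q.1 - q.2.1 ∈ P ∧ q.1 - q.2.2 ∈ P,
      (diffRep A A (q.2.1 - q.2.2) : ℝ)) ^ 2 ≤
    (∑ d ∈ (A ×ˢ A).image (fun p => p.1 - p.2), (diffRep A A d : ℝ) ^ 3) *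
      ∑ v ∈ P ×ˢ P, (diffRep A A (v.1 - v.2) : ℝ) ^ 2 := by
  have h1 : ∑ q ∈ A ×ˢ A ×ˢ A with q.1 - q.2.1 ∈ P ∧ q.1 - q.2.2 ∈ P,
      diffRep A A (q.2.1 - q.2.2) ≤
      ∑ v ∈ P ×ˢ P, #{q ∈ A ×ˢ A ×ˢ A | (q.1 - q.2.2, q.1 - q.2.1) = v} *
        diffRep A A (v.1 - v.2) := by
    rw [← sum_fiberwise_of_maps_to (t := P ×ˢ P) (g := fun q => (q.1 - q.2.2, q.1 - q.2.1))]
    · refine sum_le_sum fun v _ => ?_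
      calc _ = ∑ q ∈ {q ∈ A ×ˢ A ×ˢ A | q.1 - q.2.1 ∈ P ∧ q.1 - q.2.2 ∈ P} with
              (q.1 - q.2.2, q.1 - q.2.1) = v, diffRep A A (v.1 - v.2) := by
            refine sum_congr rfl fun q hq => ?_
            rw [← (mem_filter.1 hq).2]
            rw [sub_sub_sub_cancel_left]
        _ ≤ _ := by
            rw [sum_const, smul_eq_mul]
            exact Nat.mul_le_mul_right _ (card_le_card (filter_subset_filter _ (filter_subset _ _)))
    · intro q hq
      exact mem_product.2 (mem_filter.1 hq).2.symm
  have h2 := sum_mul_sq_le_sq_mul_sq (P ×ˢ P)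
    (fun v => (#{q ∈ A ×ˢ A ×ˢ A | (q.1 - q.2.2, q.1 - q.2.1) = v} : ℝ))
    (fun v => (diffRep A A (v.1 - v.2) : ℝ))
  calc _ ≤ _ := pow_le_pow_left₀ (sum_nonneg fun _ _ => by positivity) (by exact_mod_cast h1) 2
    _ ≤ _ := h2
    _ ≤ _ := by
        gcongr
        exact_mod_cast sum_card_sq_le_sum_cube A (P ×ˢ P)

theorem addEnergy_le_sum_sq (A : Finset G) :
    addEnergy A A ≤ ∑ d ∈ (A ×ˢ A).image (fun p => p.1 - p.2), diffRep A A d ^ 2 := by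
  rw [addEnergy, card_eq_sum_card_fiberwise (f := fun w => w.1.1 - w.1.2)
    (t := (A ×ˢ A).image (fun p => p.1 - p.2))]
  · refine sum_le_sum fun d _ => ?_
    rw [diffRep, sq, ← card_product]
    refine card_le_card_of_injOn (fun w => (w.1, w.2.swap)) ?_ ?_
    · intro w hw
      simp only [mem_coe, mem_filter, mem_product, Prod.fst_swap, Prod.snd_swap] at hw ⊢
      obtain ⟨⟨⟨⟨a1, a2⟩, b1, b2⟩, h⟩, rfl⟩ := hw
      refine ⟨⟨⟨a1, a2⟩, rfl⟩, ⟨b2, b1⟩, ?_⟩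
      rw [sub_eq_sub_iff_add_eq_add, add_comm, ← h, add_comm]
    · rintro ⟨p, q⟩ _ ⟨p', q'⟩ _ h
      simp only [Prod.mk.injEq] at h ⊢
      exact ⟨h.1, Prod.swap_injective h.2⟩
  · intro w hw
    simp only [mem_coe, mem_filter, mem_product] at hw
    exact mem_image.2 ⟨w.1, mem_product.2 hw.1.1, rfl⟩

end Triangles

/-! ### Popular differences of popular differences -/

section Levels

variable {G : Type*} [AddCommGroup G] [DecidableEq G] {A P : Finset G} {C : ℝ}

theorem sum_diffRep_sub_le (A P : Finset G) :
    ∑ v ∈ P ×ˢ P, diffRep A A (v.1 - v.2) ≤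
      #{q ∈ (A ×ˢ P) ×ˢ (A ×ˢ P) | q.1.1 - q.1.2 = q.2.1 - q.2.2} := by
  simp only [diffRep]
  rw [← card_sigma]
  refine card_le_card_of_injOn (fun w => ((w.2.1, w.1.1), (w.2.2, w.1.2))) ?_ ?_
  · rintro ⟨v, z⟩ hw
    simp only [mem_coe, mem_sigma, mem_filter, mem_product] at hw ⊢
    obtain ⟨⟨hv1, hv2⟩, ⟨hz1, hz2⟩, hz⟩ := hw
    refine ⟨⟨⟨hz1, hv1⟩, hz2, hv2⟩, ?_⟩
    rw [sub_eq_sub_iff_add_eq_add] at hz ⊢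
    rw [hz, add_comm]
  · rintro ⟨⟨p1, p2⟩, z1, z2⟩ _ ⟨⟨p1', p2'⟩, z1', z2'⟩ _ h
    simp only [Prod.mk.injEq] at h
    obtain ⟨⟨rfl, rfl⟩, rfl, rfl⟩ := h
    rfl

/-- Differences of `P` are rarely popular: `N_j = #{(a, b) ∈ P² : r(a - b) ≥ j}` satisfies
`(t N_j) ^ 4 ≪ n ^ 13 p ^ 3 / j ^ 9`, which is written here in the form convenient for `j` at
least `n ^ 3 / (p t ^ 2)`. -/
theorem HasRichBound.card_popular_pairs_le (hA : HasRichBound C A) (hC : 1 ≤ C)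
    (hA0 : A.Nonempty) {t j : ℕ} (ht : 1 ≤ t) (hj : 1 ≤ j) (hP : ∀ a ∈ P, t ≤ diffRep A A a)
    (hP0 : P.Nonempty) (hjt : (#A : ℝ) ^ 3 ≤ j * (#P * t ^ 2)) :
    (t : ℝ) ^ 2 * j ^ 2 * #{v ∈ P ×ˢ P | j ≤ diffRep A A (v.1 - v.2)} ≤
      6 * C ^ 3 * #A ^ 4 * √(#P : ℝ) := by
  set D : Finset G := {d ∈ (A ×ˢ A).image (fun p => p.1 - p.2) | j ≤ diffRep A A d} with hD
  have hDneg : ∀ d ∈ D, -d ∈ D := by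
    intro d hd
    rw [hD, mem_filter, mem_image] at hd ⊢
    obtain ⟨⟨p, hp, rfl⟩, hd⟩ := hd
    refine ⟨⟨p.swap, ?_, by simp⟩, by rwa [diffRep_neg]⟩
    rw [mem_product] at hp ⊢
    exact hp.symm
  have hn : (0 : ℝ) < #A := by exact_mod_cast hA0.card_pos
  have hp : (0 : ℝ) < #P := by exact_mod_cast hP0.card_pos
  have ht0 : (0 : ℝ) < t := by exact_mod_cast ht
  have hj0 : (0 : ℝ) < j := by exact_mod_cast hj
  have hNle : #{v ∈ P ×ˢ P | j ≤ diffRep A A (v.1 - v.2)} ≤ #{v ∈ P ×ˢ P | v.1 - v.2 ∈ D} := by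
    refine card_le_card fun v hv => ?_
    rw [mem_filter] at hv ⊢
    refine ⟨hv.1, mem_filter.2 ⟨?_, hv.2⟩⟩
    obtain ⟨z, hz⟩ := card_pos.1 (hj.trans hv.2)
    rw [mem_filter] at hz
    exact mem_image.2 ⟨z, hz⟩
  set N := #{v ∈ P ×ˢ P | j ≤ diffRep A A (v.1 - v.2)}
  have h1 : (t * N : ℝ) ≤
      (#{q ∈ (A ×ˢ P) ×ˢ (A ×ˢ D) | q.1.1 - q.1.2 = q.2.1 - q.2.2} : ℕ) := by
    exact_mod_cast (Nat.mul_le_mul_left t hNle).trans (mul_card_diff_mem_le hP hDneg)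
  have h2 := card_coincidences_sq_le A P D
  have h3 := hA.sum_sq_le (by linarith) P ((A ×ˢ P).image fun p => p.1 - p.2)
  have h4 := hA.sum_sq_le (by linarith) D ((A ×ˢ P).image fun p => p.1 - p.2)
  have h5 : (j : ℝ) ^ 3 * #D ≤ C * #A ^ 3 := by
    have := hA A D j fun d hd => (mem_filter.1 hd).2
    linarith
  have h6 : (t : ℝ) ^ 3 * #P ≤ C * #A ^ 3 := by
    have := hA A P t hP
    linarith
  set n := ((#A : ℕ) : ℝ)
  set p := ((#P : ℕ) : ℝ)
  set q := ((#D : ℕ) : ℝ)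
  have hq : 0 ≤ q := by positivity
  set sp := √p
  set sq' := √q
  have hsp : sp ^ 2 = p := Real.sq_sqrt hp.le
  have hsq : sq' ^ 2 = q := Real.sq_sqrt hq
  have hsp0 : 0 ≤ sp := Real.sqrt_nonneg _
  have hsq0 : 0 ≤ sq' := Real.sqrt_nonneg _
  have hc : 2 + 4 * C ≤ 6 * C := by linarith
  have h7 : (t * N : ℝ) ^ 2 ≤ (6 * C * n * p * sp) * (6 * C * n * q * sq') := by
    calc (t * N : ℝ) ^ 2 ≤ _ := pow_le_pow_left₀ (by positivity) h1 2
      _ ≤ _ := h2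
      _ ≤ ((2 + 4 * C) * n * p * sp) * ((2 + 4 * C) * n * q * sq') := by
          gcongr
      _ ≤ _ := by gcongr
  have h8 : (t * N : ℝ) ^ 4 ≤ (6 * C) ^ 4 * n ^ 4 * p ^ 3 * q ^ 3 := by
    calc (t * N : ℝ) ^ 4 = ((t * N : ℝ) ^ 2) ^ 2 := by ring
      _ ≤ ((6 * C * n * p * sp) * (6 * C * n * q * sq')) ^ 2 := by gcongr
      _ = (6 * C) ^ 4 * n ^ 4 * p ^ 2 * q ^ 2 * sp ^ 2 * sq' ^ 2 := by ring
      _ = _ := by rw [hsp, hsq]; ring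
  have h9 : (t ^ 2 * j ^ 2 * N : ℝ) ^ 4 * n ^ 3 ≤ (6 * C ^ 3 * n ^ 4 * sp) ^ 4 * n ^ 3 := by
    calc (t ^ 2 * j ^ 2 * N : ℝ) ^ 4 * n ^ 3 ≤ (t ^ 2 * j ^ 2 * N : ℝ) ^ 4 * (j * (p * t ^ 2)) := by
          gcongr
      _ = (t * N : ℝ) ^ 4 * (t ^ 6 * j ^ 9 * p) := by ring
      _ ≤ (6 * C) ^ 4 * n ^ 4 * p ^ 3 * q ^ 3 * (t ^ 6 * j ^ 9 * p) := by gcongr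
      _ = (6 * C) ^ 4 * n ^ 4 * p ^ 2 * (j ^ 3 * q) ^ 3 * (t ^ 3 * p) ^ 2 := by ring
      _ ≤ (6 * C) ^ 4 * n ^ 4 * p ^ 2 * (C * n ^ 3) ^ 3 * (C * n ^ 3) ^ 2 := by gcongr
      _ = 6 ^ 4 * C ^ 9 * n ^ 19 * (sp ^ 2) ^ 2 := by rw [hsp]; ring
      _ ≤ 6 ^ 4 * C ^ 12 * n ^ 19 * (sp ^ 2) ^ 2 := by
          gcongr
          norm_num
      _ = _ := by ring
  exact le_of_pow_le_pow_left₀ four_ne_zero (by positivity)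
    (le_of_mul_le_mul_right h9 (by positivity))

/-- The estimate `∑ r(a - b) ^ 2 ≪ n ^ 4 p ^ (1 / 2) t ^ (-2) log n`, the sum being over a set `P`
of `p` differences with at least `t` representations each. -/
theorem HasRichBound.sum_sq_diffRep_sub_le (hA : HasRichBound C A) (hC : 1 ≤ C)
    (hA0 : A.Nonempty) {t : ℕ} (ht : 1 ≤ t) (hP : ∀ a ∈ P, t ≤ diffRep A A a)
    (hP0 : P.Nonempty) :
    (t : ℝ) ^ 2 * ∑ v ∈ P ×ˢ P, (diffRep A A (v.1 - v.2) : ℝ) ^ 2 ≤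
      24 * C ^ 3 * #A ^ 4 * √(#P : ℝ) * (1 + Real.log #A) := by
  have hn : (1 : ℝ) ≤ #A := by exact_mod_cast hA0.card_pos
  have hp : (0 : ℝ) < #P := by exact_mod_cast hP0.card_pos
  have ht1 : (1 : ℝ) ≤ t := by exact_mod_cast ht
  have hlog : 0 ≤ Real.log #A := Real.log_nonneg hn
  have h6 : (t : ℝ) ^ 3 * #P ≤ C * #A ^ 3 := by
    have := hA A P t hP
    linarith
  -- below the threshold `D` use `E(A, P)`, above it the scarcity of popular pairs
  set R : ℝ := #A ^ 3 / (#P * t ^ 2) with hR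
  have hR0 : 0 < R := by positivity
  set D := ⌈R⌉₊ with hD
  have hRD : R ≤ D := Nat.le_ceil R
  have hD1 : 1 ≤ D := Nat.one_le_ceil_iff.2 hR0
  have hCR : 1 ≤ C * R := by
    rw [hR, ← mul_div_assoc, le_div_iff₀ (by positivity)]
    calc 1 * (#P * t ^ 2 : ℝ) ≤ t * (#P * t ^ 2) := by gcongr
      _ = t ^ 3 * #P := by ring
      _ ≤ _ := h6
  have hDR : (D : ℝ) ≤ 2 * C * R := by
    have h1 := Nat.ceil_lt_add_one hR0.le
    have h2 : R ≤ C * R := le_mul_of_one_le_left hR0.le hC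
    linarith
  have hlay : ∑ v ∈ P ×ˢ P, (diffRep A A (v.1 - v.2) : ℝ) ^ 2 ≤
      D * ∑ v ∈ P ×ˢ P, (diffRep A A (v.1 - v.2) : ℝ) +
      ∑ j ∈ Icc D #A, 2 * (j : ℝ) * #{v ∈ P ×ˢ P | j ≤ diffRep A A (v.1 - v.2)} := by
    exact_mod_cast sum_sq_le_layers (P ×ˢ P) (fun v => diffRep A A (v.1 - v.2)) D (N := #A)
      fun x _ => diffRep_le_card_left A A _
  have hlow : ∑ v ∈ P ×ˢ P, (diffRep A A (v.1 - v.2) : ℝ) ≤ 6 * C * #A * #P * √(#P : ℝ) := by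
    have h1 : ∑ v ∈ P ×ˢ P, (diffRep A A (v.1 - v.2) : ℝ) ≤
        (#{q ∈ (A ×ˢ P) ×ˢ (A ×ˢ P) | q.1.1 - q.1.2 = q.2.1 - q.2.2} : ℕ) := by
      exact_mod_cast sum_diffRep_sub_le A P
    have h2 := card_coincidences_sq_le A P P
    rw [← sq] at h2
    have h3 := hA.sum_sq_le (by linarith) P ((A ×ˢ P).image fun p => p.1 - p.2)
    have h4 := le_of_pow_le_pow_left₀ two_ne_zero (sum_nonneg fun _ _ => by positivity) h2
    have h5 : (2 + 4 * C) * #A * #P * √(#P : ℝ) ≤ 6 * C * #A * #P * √(#P : ℝ) := by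
      gcongr; linarith
    linarith
  have hhigh : ∀ j ∈ Icc D #A,
      2 * (j : ℝ) * #{v ∈ P ×ˢ P | j ≤ diffRep A A (v.1 - v.2)} ≤
      12 * C ^ 3 * #A ^ 4 * √(#P : ℝ) / t ^ 2 * (j : ℝ)⁻¹ := by
    intro j hj
    have hj1 : 1 ≤ j := hD1.trans (mem_Icc.1 hj).1
    have hj0 : (0 : ℝ) < j := by exact_mod_cast hj1
    have hRj : R ≤ j := hRD.trans (by exact_mod_cast (mem_Icc.1 hj).1)
    have h := hA.card_popular_pairs_le hC hA0 ht hj1 hP hP0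
      (by rwa [hR, div_le_iff₀ (by positivity)] at hRj)
    rw [← div_eq_mul_inv, div_div, le_div_iff₀ (by positivity)]
    linarith
  have hsum := (sum_le_sum hhigh)
  rw [← mul_sum] at hsum
  have hharm := sum_Icc_inv_le D hD1 #A
  calc (t : ℝ) ^ 2 * ∑ v ∈ P ×ˢ P, (diffRep A A (v.1 - v.2) : ℝ) ^ 2
      ≤ t ^ 2 * (2 * C * R * (6 * C * #A * #P * √(#P : ℝ)) +
        12 * C ^ 3 * #A ^ 4 * √(#P : ℝ) / t ^ 2 * (1 + Real.log #A)) := by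
        gcongr
        refine hlay.trans (add_le_add ?_ (hsum.trans ?_))
        · gcongr
        · gcongr
    _ = 12 * C ^ 2 * #A ^ 4 * √(#P : ℝ) * 1 +
        12 * C ^ 3 * #A ^ 4 * √(#P : ℝ) * (1 + Real.log #A) := by
        rw [hR]; field_simp; ring
    _ ≤ 12 * C ^ 3 * #A ^ 4 * √(#P : ℝ) * (1 + Real.log #A) +
        12 * C ^ 3 * #A ^ 4 * √(#P : ℝ) * (1 + Real.log #A) := by
        gcongr
        · norm_num
        · linarith
    _ = _ := by ring

/-- The key estimate for the set `P` of differences with at least `t` representations; with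
`p = |P|` it reads `t ^ 10 p ^ (11 / 2) ≪ n ^ 13 (log n) ^ 2`. -/
theorem HasRichBound.level_le (hA : HasRichBound C A) (hC : 1 ≤ C) (hA0 : A.Nonempty) {t : ℕ}
    (ht : 1 ≤ t) (hP : ∀ a ∈ P, t ≤ diffRep A A a) (hneg : ∀ a ∈ P, -a ∈ P) :
    (t : ℝ) ^ 10 * √(#P : ℝ) ^ 11 ≤ 72 * C ^ 4 * #A ^ 13 * (1 + Real.log #A) ^ 2 := by
  have hn : (1 : ℝ) ≤ #A := by exact_mod_cast hA0.card_pos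
  have hlog : 0 ≤ Real.log #A := Real.log_nonneg hn
  rcases P.eq_empty_or_nonempty with rfl | hP0
  · rw [card_empty, Nat.cast_zero, Real.sqrt_zero, zero_pow (by norm_num), mul_zero]
    positivity
  have hp : (0 : ℝ) < #P := by exact_mod_cast hP0.card_pos
  have h1 := mul_card_cube_le_triangles hP hneg
  have h2 := triangles_sq_le A P
  have h3 := hA.sum_cube_le (by linarith) ((A ×ˢ A).image fun p => p.1 - p.2)
  have h4 := hA.sum_sq_diffRep_sub_le hC hA0 ht hP hP0
  set T := ∑ q ∈ A ×ˢ A ×ˢ A with q.1 - q.2.1 ∈ P ∧ q.1 - q.2.2 ∈ P,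
    (diffRep A A (q.2.1 - q.2.2) : ℝ)
  set Q := ∑ v ∈ P ×ˢ P, (diffRep A A (v.1 - v.2) : ℝ) ^ 2
  set E := ∑ d ∈ (A ×ˢ A).image (fun p => p.1 - p.2), (diffRep A A d : ℝ) ^ 3
  have hQ0 : 0 ≤ Q := sum_nonneg fun _ _ => by positivity
  have hs0 : 0 < √(#P : ℝ) := Real.sqrt_pos.2 hp
  have hs : √(#P : ℝ) ^ 2 = #P := Real.sq_sqrt hp.le
  set s := √(#P : ℝ)
  set n := ((#A : ℕ) : ℝ)
  set L := 1 + Real.log n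
  have h5 : (t : ℝ) ^ 10 * s ^ 11 * s ≤ 72 * C ^ 4 * n ^ 13 * L ^ 2 * s := by
    calc (t : ℝ) ^ 10 * s ^ 11 * s = t ^ 2 * (t * (t * s ^ 2) ^ 3) ^ 2 := by ring
      _ ≤ t ^ 2 * (n ^ 3 * T) ^ 2 := by rw [hs]; gcongr
      _ = n ^ 6 * t ^ 2 * T ^ 2 := by ring
      _ ≤ n ^ 6 * t ^ 2 * (E * Q) := by gcongr
      _ = n ^ 6 * E * (t ^ 2 * Q) := by ring
      _ ≤ n ^ 6 * (3 * C * n ^ 3 * L) * (24 * C ^ 3 * n ^ 4 * s * L) := by gcongr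
      _ = _ := by ring
  exact le_of_mul_le_mul_right h5 hs0

end Levels

/-! ### Summation over the levels -/

theorem sum_range_rpow_le (D : ℕ) :
    ∑ j ∈ range (D + 1), (j : ℝ) ^ (-(9 / 11) : ℝ) ≤ 11 / 2 * (D : ℝ) ^ (2 / 11 : ℝ) := by
  induction D with
  | zero => norm_num [Real.zero_rpow]
  | succ D ih =>
    rw [sum_range_succ]
    refine (add_le_add_left ih _).trans ?_
    have hD : (0 : ℝ) < D + 1 := by positivity
    have h := rpow_one_add_le_one_add_mul_self (s := -(1 / ((D : ℝ) + 1))) (p := 2 / 11)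
      (by rw [neg_le_neg_iff, div_le_one hD]; linarith [D.cast_nonneg (α := ℝ)])
      (by norm_num) (by norm_num)
    have e1 : (D : ℝ) = (D + 1) * (1 + -(1 / ((D : ℝ) + 1))) := by field_simp; ring
    have e2 : (D : ℝ) ^ (2 / 11 : ℝ) =
        (D + 1 : ℝ) ^ (2 / 11 : ℝ) * (1 + -(1 / ((D : ℝ) + 1))) ^ (2 / 11 : ℝ) := by
      rw [← Real.mul_rpow hD.le, ← e1]
      have : (1 / ((D : ℝ) + 1)) ≤ 1 := by
        rw [div_le_one hD]; linarith [D.cast_nonneg (α := ℝ)]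
      linarith
    have e3 : (D + 1 : ℝ) ^ (-(9 / 11) : ℝ) = (D + 1 : ℝ) ^ (2 / 11 : ℝ) / (D + 1) := by
      rw [← Real.rpow_sub_one hD.ne']; norm_num
    push_cast
    rw [e2, e3]
    have h2 : (0 : ℝ) ≤ (D + 1 : ℝ) ^ (2 / 11 : ℝ) := by positivity
    have h3 := mul_le_mul_of_nonneg_left h h2
    calc 11 / 2 * ((D + 1 : ℝ) ^ (2 / 11 : ℝ) * (1 + -(1 / ((D : ℝ) + 1))) ^ (2 / 11 : ℝ)) +
          (D + 1 : ℝ) ^ (2 / 11 : ℝ) / (D + 1)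
        ≤ 11 / 2 * ((D + 1 : ℝ) ^ (2 / 11 : ℝ) * (1 + 2 / 11 * -(1 / ((D : ℝ) + 1)))) +
          (D + 1 : ℝ) ^ (2 / 11 : ℝ) / (D + 1) := by gcongr
      _ = 11 / 2 * (D + 1 : ℝ) ^ (2 / 11 : ℝ) := by ring

theorem le_rpow_of_sqrt_pow_le {t p B : ℝ} (ht : 0 < t) (hp : 0 ≤ p)
    (h : t ^ 10 * √p ^ 11 ≤ B) : t * p ≤ B ^ (2 / 11 : ℝ) * t ^ (-(9 / 11) : ℝ) := by
  have h1 : √p ^ 11 = p ^ (11 / 2 : ℝ) := by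
    rw [Real.sqrt_eq_rpow, ← Real.rpow_natCast, ← Real.rpow_mul hp]; norm_num
  have h2 : t ^ 10 = t ^ (10 : ℝ) := by norm_cast
  rw [h1, h2] at h
  have h3 := Real.rpow_le_rpow (by positivity) h (show (0 : ℝ) ≤ 2 / 11 by norm_num)
  rw [Real.mul_rpow (by positivity) (by positivity), ← Real.rpow_mul ht.le,
    ← Real.rpow_mul hp] at h3
  norm_num at h3
  have h4 : t = t ^ (20 / 11 : ℝ) * t ^ (-(9 / 11) : ℝ) := by
    rw [← Real.rpow_add ht]; norm_num
  calc t * p = t ^ (20 / 11 : ℝ) * p * t ^ (-(9 / 11) : ℝ) := by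
        nth_rw 1 [h4]; ring
    _ ≤ _ := by gcongr

/-- Sets with the Szemerédi–Trotter type property have additive energy
`≪ |A| ^ (32 / 13) (log |A|) ^ (4 / 13)`. -/
theorem HasRichBound.exists_addEnergy_le {G : Type*} [AddCommGroup G] [DecidableEq G] {C : ℝ}
    (hC : 1 ≤ C) :
    ∃ K : ℝ, 0 < K ∧ ∀ A : Finset G, HasRichBound C A → A.Nonempty →
      (addEnergy A A : ℝ) ≤ K * (#A : ℝ) ^ (32 / 13 : ℝ) * (1 + Real.log #A) ^ (4 / 13 : ℝ) := by
  refine ⟨11 * (72 * C ^ 4) ^ (2 / 11 : ℝ) * 2 ^ (2 / 11 : ℝ) + 4 * C, by positivity,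
    fun A hA hA0 => ?_⟩
  have hn : (1 : ℝ) ≤ #A := by exact_mod_cast hA0.card_pos
  have hn0 : (0 : ℝ) < #A := by linarith
  have hlog : 0 ≤ Real.log #A := Real.log_nonneg hn
  set L := 1 + Real.log #A with hL
  have hL1 : 1 ≤ L := by linarith
  have hL0 : 0 < L := by linarith
  have hLn : L ≤ #A := by linarith [Real.log_le_sub_one_of_pos hn0]
  set B := 72 * C ^ 4 * (#A : ℝ) ^ 13 * L ^ 2 with hB
  have hB0 : 0 ≤ B := by positivity
  set I := (A ×ˢ A).image fun p => p.1 - p.2 with hI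
  have hlevel : ∀ j : ℕ, 1 ≤ j → (j : ℝ) ^ 10 * √(#{d ∈ I | j ≤ diffRep A A d} : ℝ) ^ 11 ≤ B := by
    intro j hj
    refine hA.level_le hC hA0 hj (fun a ha => (mem_filter.1 ha).2) fun a ha => ?_
    rw [mem_filter, hI, mem_image] at ha ⊢
    obtain ⟨⟨p, hp, rfl⟩, ha⟩ := ha
    refine ⟨⟨p.swap, ?_, by simp⟩, by rwa [diffRep_neg]⟩
    rw [mem_product] at hp ⊢
    exact hp.symm
  -- the two bounds for the number of `j`-popular differences balance at `j = R`
  set R : ℝ := (#A : ℝ) ^ (7 / 13 : ℝ) * L ^ (-(4 / 13) : ℝ) with hR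
  have hR1 : 1 ≤ R := by
    rw [hR, Real.rpow_neg hL0.le, ← div_eq_mul_inv, one_le_div (by positivity)]
    calc L ^ (4 / 13 : ℝ) ≤ L ^ (7 / 13 : ℝ) :=
          Real.rpow_le_rpow_of_exponent_le hL1 (by norm_num)
      _ ≤ _ := by gcongr
  set D := ⌈R⌉₊ with hD
  have hRD : R ≤ D := Nat.le_ceil R
  have hDR : (D : ℝ) ≤ 2 * R := by linarith [Nat.ceil_lt_add_one (show 0 ≤ R by linarith)]
  have hlay : ∑ d ∈ I, (diffRep A A d : ℝ) ^ 2 ≤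
      ∑ j ∈ Icc 0 #A, 2 * (j : ℝ) * #{d ∈ I | j ≤ diffRep A A d} := by
    have := sum_sq_le_layers I (diffRep A A) 0 (N := #A) fun x _ => diffRep_le_card_left A A x
    rw [zero_mul, zero_add] at this
    exact_mod_cast this
  have hE : (addEnergy A A : ℝ) ≤ ∑ d ∈ I, (diffRep A A d : ℝ) ^ 2 := by
    exact_mod_cast addEnergy_le_sum_sq A
  have hlow : ∑ j ∈ Icc 0 #A with j ≤ D, 2 * (j : ℝ) * #{d ∈ I | j ≤ diffRep A A d} ≤
      2 * B ^ (2 / 11 : ℝ) * (11 / 2 * (D : ℝ) ^ (2 / 11 : ℝ)) := by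
    calc _ ≤ ∑ j ∈ range (D + 1), 2 * (j : ℝ) * #{d ∈ I | j ≤ diffRep A A d} := by
          refine sum_le_sum_of_subset_of_nonneg (fun j hj => ?_) fun _ _ _ => by positivity
          rw [mem_filter] at hj
          exact mem_range.2 (by omega)
      _ ≤ ∑ j ∈ range (D + 1), 2 * B ^ (2 / 11 : ℝ) * (j : ℝ) ^ (-(9 / 11) : ℝ) := by
          refine sum_le_sum fun j _ => ?_
          rcases Nat.eq_zero_or_pos j with rfl | hj
          · simp only [Nat.cast_zero, mul_zero, zero_mul]; positivity
          · have := le_rpow_of_sqrt_pow_le (by exact_mod_cast hj) (Nat.cast_nonneg _)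
              (hlevel j hj)
            linarith
      _ ≤ _ := by
          rw [← mul_sum]
          gcongr
          exact sum_range_rpow_le D
  have hhigh : ∑ j ∈ Icc 0 #A with ¬ j ≤ D, 2 * (j : ℝ) * #{d ∈ I | j ≤ diffRep A A d} ≤
      2 * C * (#A : ℝ) ^ 3 * (2 / R) := by
    calc _ ≤ ∑ j ∈ Icc (D + 1) #A, 2 * (j : ℝ) * #{d ∈ I | j ≤ diffRep A A d} := by
          refine sum_le_sum_of_subset_of_nonneg (fun j hj => ?_) fun _ _ _ => by positivity
          rw [mem_filter, mem_Icc] at hj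
          exact mem_Icc.2 (by omega)
      _ ≤ ∑ j ∈ Icc (D + 1) #A, 2 * C * (#A : ℝ) ^ 3 * ((j : ℝ) ^ 2)⁻¹ := by
          refine sum_le_sum fun j hj => ?_
          have hj0 : (0 : ℝ) < j := by
            exact_mod_cast (Nat.succ_pos D).trans_le (mem_Icc.1 hj).1
          have := hA A {d ∈ I | j ≤ diffRep A A d} j fun d hd => (mem_filter.1 hd).2
          rw [← div_eq_mul_inv, le_div_iff₀ (by positivity)]
          linarith
      _ ≤ _ := by
          rw [← mul_sum]
          gcongr
          refine (sum_Icc_inv_sq_le (by omega) _).trans ?_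
          gcongr
          push_cast
          linarith
  have hsplit := sum_filter_add_sum_filter_not (Icc 0 #A) (fun j => j ≤ D)
    (fun j => 2 * (j : ℝ) * #{d ∈ I | j ≤ diffRep A A d})
  have hDpow : (D : ℝ) ^ (2 / 11 : ℝ) ≤ 2 ^ (2 / 11 : ℝ) * R ^ (2 / 11 : ℝ) := by
    rw [← Real.mul_rpow (by norm_num) (by linarith)]
    gcongr
  have hmain : B ^ (2 / 11 : ℝ) * R ^ (2 / 11 : ℝ) = (72 * C ^ 4) ^ (2 / 11 : ℝ) *
      ((#A : ℝ) ^ (32 / 13 : ℝ) * L ^ (4 / 13 : ℝ)) := by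
    have e1 : (#A : ℝ) ^ 13 = (#A : ℝ) ^ (13 : ℝ) := by norm_cast
    have e2 : L ^ 2 = L ^ (2 : ℝ) := by norm_cast
    rw [hB, hR, e1, e2, Real.mul_rpow (y := L ^ (2 : ℝ)) (by positivity) (by positivity),
      Real.mul_rpow (x := 72 * C ^ 4) (by positivity) (by positivity),
      Real.mul_rpow (x := (#A : ℝ) ^ (7 / 13 : ℝ)) (by positivity) (by positivity),
      ← Real.rpow_mul hn0.le, ← Real.rpow_mul hL0.le, ← Real.rpow_mul hn0.le,
      ← Real.rpow_mul hL0.le]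
    calc (72 * C ^ 4) ^ (2 / 11 : ℝ) * (#A : ℝ) ^ (13 * (2 / 11) : ℝ) * L ^ (2 * (2 / 11) : ℝ) *
          ((#A : ℝ) ^ (7 / 13 * (2 / 11) : ℝ) * L ^ (-(4 / 13) * (2 / 11) : ℝ))
        = (72 * C ^ 4) ^ (2 / 11 : ℝ) *
          (((#A : ℝ) ^ (13 * (2 / 11) : ℝ) * (#A : ℝ) ^ (7 / 13 * (2 / 11) : ℝ)) *
          (L ^ (2 * (2 / 11) : ℝ) * L ^ (-(4 / 13) * (2 / 11) : ℝ))) := by ring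
      _ = _ := by
          rw [← Real.rpow_add hn0, ← Real.rpow_add hL0]
          norm_num
  have htail : (#A : ℝ) ^ 3 / R = (#A : ℝ) ^ (32 / 13 : ℝ) * L ^ (4 / 13 : ℝ) := by
    have e1 : (#A : ℝ) ^ 3 = (#A : ℝ) ^ (3 : ℝ) := by norm_cast
    have e2 : (3 : ℝ) = 32 / 13 + 7 / 13 := by norm_num
    rw [hR, e1, Real.rpow_neg hL0.le, e2, Real.rpow_add hn0]
    field_simp
  calc (addEnergy A A : ℝ) ≤ 2 * B ^ (2 / 11 : ℝ) * (11 / 2 * (D : ℝ) ^ (2 / 11 : ℝ)) +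
        2 * C * (#A : ℝ) ^ 3 * (2 / R) := by linarith
    _ ≤ 2 * B ^ (2 / 11 : ℝ) * (11 / 2 * (2 ^ (2 / 11 : ℝ) * R ^ (2 / 11 : ℝ))) +
        2 * C * (#A : ℝ) ^ 3 * (2 / R) := by gcongr
    _ = 11 * 2 ^ (2 / 11 : ℝ) * (B ^ (2 / 11 : ℝ) * R ^ (2 / 11 : ℝ)) +
        4 * C * ((#A : ℝ) ^ 3 / R) := by ring
    _ = _ := by rw [hmain, htail]; ring

theorem one_add_log_rpow_le {n : ℝ} (hn : 2 ≤ n) :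
    (1 + Real.log n) ^ (4 / 13 : ℝ) ≤ 2 * Real.logb 2 n ^ (71 / 65 : ℝ) := by
  have hlog2 : 0 < Real.log 2 := Real.log_pos (by norm_num)
  have h1 : 1 ≤ Real.logb 2 n := by
    rw [Real.le_logb_iff_rpow_le (by norm_num) (by linarith)]
    simpa using hn
  have h2 : Real.log n ≤ Real.logb 2 n := by
    rw [Real.logb, le_div_iff₀ hlog2]
    have h3 : Real.log 2 ≤ 1 := by linarith [Real.log_two_lt_d9]
    have h4 : 0 ≤ Real.log n := Real.log_nonneg (by linarith)
    nlinarith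
  have h3 : 0 ≤ Real.log n := Real.log_nonneg (by linarith)
  calc (1 + Real.log n) ^ (4 / 13 : ℝ) ≤ (2 * Real.logb 2 n) ^ (4 / 13 : ℝ) := by
        gcongr; linarith
    _ = 2 ^ (4 / 13 : ℝ) * Real.logb 2 n ^ (4 / 13 : ℝ) :=
        Real.mul_rpow (by norm_num) (by linarith)
    _ ≤ 2 ^ (1 : ℝ) * Real.logb 2 n ^ (71 / 65 : ℝ) := by
        have e1 : (2 : ℝ) ^ (4 / 13 : ℝ) ≤ 2 ^ (1 : ℝ) :=
          Real.rpow_le_rpow_of_exponent_le (by norm_num) (by norm_num)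
        have e2 : Real.logb 2 n ^ (4 / 13 : ℝ) ≤ Real.logb 2 n ^ (71 / 65 : ℝ) :=
          Real.rpow_le_rpow_of_exponent_le h1 (by norm_num)
        gcongr
    _ = _ := by rw [Real.rpow_one]

theorem exists_addEnergy_le_of_isConvexSet :
    ∃ C : ℝ, 0 < C ∧ ∀ A : Finset ℝ, IsConvexSet A → 2 ≤ #A →
      (addEnergy A A : ℝ) ≤
        C * (#A : ℝ) ^ (32 / 13 : ℝ) * (Real.logb 2 #A) ^ (71 / 65 : ℝ) := by
  obtain ⟨K, hK, h⟩ := HasRichBound.exists_addEnergy_le (G := ℝ) (C := 2592) (by norm_num)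
  refine ⟨K * 2, by positivity, fun A hA hA2 => ?_⟩
  have h1 := h A hA.hasRichBound (card_pos.1 (by omega))
  have h2 := one_add_log_rpow_le (n := #A) (by exact_mod_cast hA2)
  calc (addEnergy A A : ℝ) ≤ _ := h1
    _ ≤ K * (#A : ℝ) ^ (32 / 13 : ℝ) * (2 * Real.logb 2 #A ^ (71 / 65 : ℝ)) := by gcongr
    _ = _ := by ring

/-! ### Fourth moments of trigonometric polynomials -/

section Integers

theorem isConvexSet_image_intCast {A : Finset ℤ} (hA : IsConvexSet A) :
    IsConvexSet (A.image (Int.cast : ℤ → ℝ)) := by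
  obtain ⟨a, himg, ha⟩ := hA
  have hcard : #(A.image (Int.cast : ℤ → ℝ)) = #A := card_image_of_injective _ Int.cast_injective
  refine ⟨fun i => a i, ?_, ?_⟩
  · rw [hcard, coe_image, ← himg, Set.image_image]
  · intro i hi
    rw [hcard] at hi
    have := ha i hi
    beta_reduce
    exact_mod_cast this

theorem addEnergy_image_intCast (A : Finset ℤ) :
    addEnergy A A ≤ addEnergy (A.image (Int.cast : ℤ → ℝ)) (A.image (Int.cast : ℤ → ℝ)) := by
  rw [addEnergy, addEnergy]
  refine card_le_card_of_injOn
    (fun w => (((w.1.1 : ℝ), (w.1.2 : ℝ)), ((w.2.1 : ℝ), (w.2.2 : ℝ)))) ?_ ?_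
  · intro w hw
    simp only [mem_coe, mem_filter, mem_product] at hw ⊢
    obtain ⟨⟨⟨h1, h2⟩, h3, h4⟩, h⟩ := hw
    exact ⟨⟨⟨mem_image_of_mem _ h1, mem_image_of_mem _ h2⟩, mem_image_of_mem _ h3,
      mem_image_of_mem _ h4⟩, by exact_mod_cast h⟩
  · rintro ⟨⟨a, b⟩, c, d⟩ _ ⟨⟨a', b'⟩, c', d'⟩ _ h
    simpa using h

theorem integral_exp_int (m : ℤ) :
    ∫ θ in (0 : ℝ)..7, Complex.exp (2 * (Real.pi : ℂ) * Complex.I * (m : ℂ) * (θ : ℂ)) =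
      if m = 0 then 7 else 0 := by
  split_ifs with h
  · simp [h]
  · have hc : 2 * (Real.pi : ℂ) * Complex.I * (m : ℂ) ≠ 0 := by
      simp [h, Real.pi_ne_zero]
    rw [integral_exp_mul_complex hc]
    have e : 2 * (Real.pi : ℂ) * Complex.I * (m : ℂ) * ((7 : ℝ) : ℂ) =
        ((7 * m : ℤ) : ℂ) * (2 * (Real.pi : ℂ) * Complex.I) := by
      push_cast; ring
    rw [e, Complex.exp_int_mul_two_pi_mul_I]
    simp

theorem trigPoly_norm_pow_four (A : Finset ℤ) (θ : ℝ) :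
    ((‖trigPoly A θ‖ ^ 4 : ℝ) : ℂ) = ∑ w ∈ (A ×ˢ A) ×ˢ (A ×ˢ A),
      Complex.exp (2 * (Real.pi : ℂ) * Complex.I *
        ((w.1.1 + w.2.1 - (w.1.2 + w.2.2) : ℤ) : ℂ) * (θ : ℂ)) := by
  have hconj : (starRingEnd ℂ) (trigPoly A θ) =
      ∑ a ∈ A, Complex.exp (-(2 * (Real.pi : ℂ) * Complex.I * (a : ℂ) * (θ : ℂ))) := by
    rw [trigPoly, map_sum]
    refine sum_congr rfl fun a _ => ?_
    rw [← Complex.exp_conj]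
    congr 1
    simp [Complex.conj_ofNat]
  have hsq : ((‖trigPoly A θ‖ ^ 2 : ℝ) : ℂ) = ∑ p ∈ A ×ˢ A,
      Complex.exp (2 * (Real.pi : ℂ) * Complex.I * ((p.1 - p.2 : ℤ) : ℂ) * (θ : ℂ)) := by
    push_cast
    rw [← Complex.mul_conj', hconj, trigPoly, sum_mul_sum, sum_product]
    refine sum_congr rfl fun a _ => sum_congr rfl fun b _ => ?_
    rw [← Complex.exp_add]
    congr 1
    push_cast; ring
  have h4 : ((‖trigPoly A θ‖ ^ 4 : ℝ) : ℂ) =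
      ((‖trigPoly A θ‖ ^ 2 : ℝ) : ℂ) * ((‖trigPoly A θ‖ ^ 2 : ℝ) : ℂ) := by
    push_cast; ring
  rw [h4, hsq, sum_mul_sum, sum_product (s := A ×ˢ A)]
  refine sum_congr rfl fun p _ => sum_congr rfl fun q _ => ?_
  rw [← Complex.exp_add]
  congr 1
  push_cast; ring

/-- The fourth moment over seven full periods; the interval `[0, 2π]` is contained in them. -/
theorem integral_trigPoly_pow_four (A : Finset ℤ) :
    ∫ θ in (0 : ℝ)..7, ‖trigPoly A θ‖ ^ 4 = 7 * addEnergy A A := by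
  have h : ((∫ θ in (0 : ℝ)..7, ‖trigPoly A θ‖ ^ 4 : ℝ) : ℂ) = 7 * (addEnergy A A : ℂ) := by
    rw [← intervalIntegral.integral_ofReal]
    simp only [trigPoly_norm_pow_four]
    rw [intervalIntegral.integral_finsetSum fun w _ =>
      Continuous.intervalIntegrable (by fun_prop) _ _]
    simp only [integral_exp_int]
    rw [← sum_filter, sum_const, nsmul_eq_mul, mul_comm, addEnergy]
    congr 3
    ext w
    simp only [mem_filter, sub_eq_zero]
  exact_mod_cast h

theorem integral_trigPoly_le (A : Finset ℤ) :
    ∫ θ in (0 : ℝ)..(2 * Real.pi), ‖trigPoly A θ‖ ^ 4 ≤ 7 * addEnergy A A := by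
  rw [← integral_trigPoly_pow_four]
  refine intervalIntegral.integral_mono_interval le_rfl (by positivity)
    (by linarith [Real.pi_lt_d2]) (Filter.Eventually.of_forall fun θ => by positivity) ?_
  refine Continuous.intervalIntegrable ?_ _ _
  unfold trigPoly
  fun_prop

end Integers

theorem theoremt :
    (∃ C : ℝ, 0 < C ∧ ∀ A : Finset ℝ, IsConvexSet A → 2 ≤ A.card →
      (Finset.addEnergy A A : ℝ) ≤
        C * (A.card : ℝ) ^ (32 / 13 : ℝ) * (Real.logb 2 (A.card : ℝ)) ^ (71 / 65 : ℝ)) ∧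
    (∃ C : ℝ, 0 < C ∧ ∀ A : Finset ℤ, IsConvexSet A → 2 ≤ A.card →
      (∫ θ in (0 : ℝ)..(2 * Real.pi), ‖trigPoly A θ‖ ^ 4) ≤
        C * (A.card : ℝ) ^ (32 / 13 : ℝ) * (Real.logb 2 (A.card : ℝ)) ^ (71 / 65 : ℝ)) := by
  obtain ⟨C, hC, h⟩ := exists_addEnergy_le_of_isConvexSet
  refine ⟨⟨C, hC, h⟩, 7 * C, by positivity, fun A hA hA2 => ?_⟩
  have hcard : #(A.image (Int.cast : ℤ → ℝ)) = #A := card_image_of_injective _ Int.cast_injective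
  have h1 := h _ (isConvexSet_image_intCast hA) (by rwa [hcard])
  rw [hcard] at h1
  have h2 : (addEnergy A A : ℝ) ≤
      addEnergy (A.image (Int.cast : ℤ → ℝ)) (A.image (Int.cast : ℤ → ℝ)) := by
    exact_mod_cast addEnergy_image_intCast A
  linarith [integral_trigPoly_le A]
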